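/- **Setup.** Let $\mathcal X,\mathcal Y_1,\mathcal Y_2$ be finite alphabets and let $P=P_{XY_1Y_2}$ and $\bar P=\bar P_{XY_1Y_2}$ be pmfs on $\mathcal X\times\mathcal Y_1\times\mathcal Y_2$; write $(X,Y_1,Y_2)\sim P$ and $(\bar X,\bar Y_1,\bar Y_2)\sim\bar P$. Under hypothesis $\mathcal H=0$ the triples $(X_t,Y_{1,t},Y_{2,t})$, $t=1,\dots,n$, are i.i.d. $P$, and under $\mathcal H=1$ they are i.i.d. $\bar P$. A sensor sends $M_1=\phi_{1,n}(X^n)\in\{0,\dots,W_{1,n}-1\}$ to both detectors. Detector 1 sends $M_2=\phi_{2,n}(M_1,Y_1^n)\in\{0,\dots,W_{2,n}-1\}$ to Detector 2 and decides $\hat{\mathcal H}_1=\psi_{1,n}(M_1,Y_1^n)\in\{0,1\}$. Detector 2 decides $\hat{\mathcal H}_2=\psi_{2,n}(M_1,M_2,Y_2^n)\in\{0,1\}$. All logarithms (in rates, exponents and information quantities) are natural. *Concurrent detection* means that Detector 1 is interested in the exponent under $\mathcal H=0$ and Detector 2 in the exponent under $\mathcal H=1$: put $$\alpha_{1,n}=\Pr[\hat{\mathcal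 H}_1=0\mid\mathcal H=1],\quad \beta_{1,n}=\Pr[\hat{\mathcal H}_1=1\mid\mathcal H=0],\quad \alpha_{2,n}=\Pr[\hat{\mathcal H}_2=1\mid\mathcal H=0],\quad \beta_{2,n}=\Pr[\hat{\mathcal H}_2=0\mid\mathcal H=1].$$ A pair $(\theta_1,\theta_2)$ is *achievable* at rates $R_1,R_2\ge 0$ if for every blocklength $n$ there are functions as above such that, for $i=1,2$, $\limsup_n\alpha_{i,n}\le 0$, $\theta_i\le\liminf_n-\frac1n\log\beta_{i,n}$ and $\limsup_n\frac1n\log W_{i,n}\le R_i$. The exponents region $\mathcal E(R_1,R_2)$ is the closure of the set of achievable pairs. **Auxiliaries.** All auxiliary random variables take values in finite sets, and $D(\cdot\|\cdot)$ is the Kullback-Leibler divergence, equal to $+\infty$ if absolute continuity fails. * $\mathcal S(R_1)$ is the set of all $\bar U_1$ with $\bar U_1-\bar X-\bar Y_1$ a Markov chain and $I(\bar U_1;\bar X)\le R_1$. Given $\bar U_1$, let $U_1$ satisfy the Markov chain $U_1-X-Y_1$ and $P_{U_1|X}=\bar P_{\bar U_1|\bar X}$, and let $\bar{\mathcal L}_1(\bar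 U_1)$ be the set of all $(\tilde U_1,\tilde X,\tilde Y_1)$ with $P_{\tilde U_1\tilde X}=P_{\bar U_1\bar X}$ and $P_{\tilde U_1\tilde Y_1}=P_{\bar U_1\bar Y_1}$. * $\mathcal S(R_1,R_2)$ is the set of all $(U,V)$ with Markov chains $U-X-(Y_1,Y_2)$ and $V-(Y_1,U)-(Y_2,X)$ and with $I(U;X)\le R_1$, $I(V;Y_1|U)\le R_2$. Given $(U,V)$, let $(\bar U,\bar V)$ satisfy $P_{\bar U|\bar X}=P_{U|X}$, $P_{\bar V|\bar Y_1\bar U}=P_{V|Y_1U}$ and the Markov chains $\bar U-\bar X-(\bar Y_1,\bar Y_2)$ and $\bar V-(\bar Y_1,\bar U)-(\bar X,\bar Y_2)$, and let $\mathcal L_2(UV)$ be the set of all $(\tilde U,\tilde V,\tilde X,\tilde Y_1,\tilde Y_2)$ with $P_{\tilde U\tilde X}=P_{UX}$, $P_{\tilde U\tilde V\tilde Y_1}=P_{UVY_1}$ and $P_{\tilde U\tilde V\tilde Y_2}=P_{UVY_2}$. Equalities of conditional laws are required at those values of the conditioning variables that have positive probability under both laws; the minima below do not depend on the remaining choices.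 **Theorem.** Let $P_X\ne\bar P_X$ and $R_1,R_2\ge 0$. Under concurrent detection, $\mathcal E(R_1,R_2)$ contains all pairs $(\theta_1,\theta_2)$ of nonnegative reals such that for some $\bar U_1\in\mathcal S(R_1)$ $$\theta_1\le\min_{(\tilde U_1,\tilde X,\tilde Y_1)\in\bar{\mathcal L}_1(\bar U_1)}D(\tilde U_1\tilde X\tilde Y_1\,\|\,U_1XY_1)$$ and for some $(U,V)\in\mathcal S(R_1,R_2)$ $$\theta_2\le\min_{(\tilde U,\tilde V,\tilde X,\tilde Y_1,\tilde Y_2)\in\mathcal L_2(UV)}D(\tilde U\tilde V\tilde X\tilde Y_1\tilde Y_2\,\|\,\bar U\bar V\bar X\bar Y_1\bar Y_2).$$ The two conditions involve separate auxiliaries, so $\mathcal E(R_1,R_2)$ contains the full product of the set of such $\theta_1$ and the set of such $\theta_2$ (a rectangle: there is no tradeoff between the two exponents in this inner region). -/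

import Mathlib

open Filter
open scoped ENNReal

noncomputable section

namespace ConcurrentDetection

/-! ### Laws on finite alphabets and information measures (natural logarithms) -/

/-- Kullback-Leibler divergence `D(p ‖ q)` of two pmfs, with value `∞` unless `p ≪ q`. -/
def relEntropy {α : Type*} (p q : PMF α) : ℝ≥0∞ :=
  @InformationTheory.klDiv α ⊤ (@PMF.toMeasure α ⊤ p) (@PMF.toMeasure α ⊤ q)

/-- Mutual information `I(A;B)` of a pair `(A,B)` with joint pmf `p`. -/
def mutualInfo {α β : Type*} [Fintype α] [Fintype β] (p : PMF (α × β)) : ℝ :=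
  ∑ a, ∑ b, (p (a, b)).toReal *
    Real.log ((p (a, b)).toReal / ((p.map Prod.fst a).toReal * (p.map Prod.snd b).toReal))

/-- Conditional mutual information `I(A;B|C)` of a triple `(A,B,C)` with joint pmf `p`. -/
def condMutualInfo {α β γ : Type*} [Fintype α] [Fintype β] [Fintype γ]
    (p : PMF (α × β × γ)) : ℝ :=
  ∑ a, ∑ b, ∑ c, (p (a, b, c)).toReal *
    Real.log (((p (a, b, c)).toReal * (p.map (fun (_, _, c') => c') c).toReal) /
      ((p.map (fun (a', _, c') => (a', c')) (a, c)).toReal *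
        (p.map (fun (_, b', c') => (b', c')) (b, c)).toReal))

/-- The Markov chain `A - B - C` for a triple with joint pmf `p`. -/
def IsMarkovChain {α β γ : Type*} (p : PMF (α × β × γ)) : Prop :=
  ∀ a b c, p (a, b, c) * p.map (fun (_, b', _) => b') b =
    p.map (fun (a', b', _) => (a', b')) (a, b) * p.map (fun (_, b', c') => (b', c')) (b, c)

/-- Equality of the conditional laws of the first component given the second one, under the joint
pmfs `p` and `q`, at every value of the second component that has positive probability under
both. -/
def SameConditional {α β : Type*} (p q : PMF (α × β)) : Prop :=
  ∀ a b, p (a, b) * q.map Prod.snd b = q (a, b) * p.map Prod.snd b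

/-! ### Codes, error probabilities and the exponents region -/

/-- Encoding and decision functions of blocklength `n` with message alphabets of sizes
`W₁` and `W₂`. -/
structure Code (X Y₁ Y₂ : Type*) (n W₁ W₂ : ℕ) where
  /-- encoder of the sensor -/
  φ₁ : (Fin n → X) → Fin W₁
  /-- encoder of Detector 1 -/
  φ₂ : Fin W₁ → (Fin n → Y₁) → Fin W₂
  /-- decision of Detector 1 -/
  ψ₁ : Fin W₁ → (Fin n → Y₁) → Fin 2
  /-- decision of Detector 2 -/
  ψ₂ : Fin W₁ → Fin W₂ → (Fin n → Y₂) → Fin 2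

section Codes

variable {X Y₁ Y₂ : Type*}

/-- The guess of Detector 1 on the observed sequences `ω`. -/
def Code.guess₁ {n W₁ W₂ : ℕ} (c : Code X Y₁ Y₂ n W₁ W₂) (ω : Fin n → X × Y₁ × Y₂) : Fin 2 :=
  c.ψ₁ (c.φ₁ fun t => (ω t).1) (fun t => (ω t).2.1)

/-- The guess of Detector 2 on the observed sequences `ω`. -/
def Code.guess₂ {n W₁ W₂ : ℕ} (c : Code X Y₁ Y₂ n W₁ W₂) (ω : Fin n → X × Y₁ × Y₂) : Fin 2 :=
  c.ψ₂ (c.φ₁ fun t => (ω t).1)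
    (c.φ₂ (c.φ₁ fun t => (ω t).1) (fun t => (ω t).2.1)) (fun t => (ω t).2.2)

/-- Probability of the event `E` for `n` i.i.d. draws from the pmf `p`. -/
def iidProb {α : Type*} [Fintype α] (p : PMF α) (n : ℕ) (E : Set (Fin n → α)) : ℝ≥0∞ :=
  ∑ ω : Fin n → α, E.indicator (fun ω => ∏ t, p (ω t)) ω

variable [Fintype X] [Fintype Y₁] [Fintype Y₂]

/-- Achievability of the pair `(θ₁, θ₂)` at rates `(R₁, R₂)`; `law h` is the law of one observation
under hypothesis `h`, and `hbar₁` is the hypothesis under which Detector 1 wants its error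
probability to decay exponentially (in `Fin 2`, `hbar₁ + 1` is the other hypothesis). -/
def Achievable (law : Fin 2 → PMF (X × Y₁ × Y₂)) (hbar₁ : Fin 2) (R₁ R₂ θ₁ θ₂ : ℝ) : Prop :=
  ∃ (W₁ W₂ : ℕ → ℕ) (c : ∀ n, Code X Y₁ Y₂ n (W₁ n) (W₂ n)),
    limsup (fun n => iidProb (law (hbar₁ + 1)) n {ω | (c n).guess₁ ω = hbar₁}) atTop ≤ 0 ∧
    limsup (fun n => iidProb (law 0) n {ω | (c n).guess₂ ω = 1}) atTop ≤ 0 ∧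
    (θ₁ : EReal) ≤ liminf (fun n : ℕ => ((-(1 / (n : ℝ)) : ℝ) : EReal) *
      ENNReal.log (iidProb (law hbar₁) n {ω | (c n).guess₁ ω = hbar₁ + 1})) atTop ∧
    (θ₂ : EReal) ≤ liminf (fun n : ℕ => ((-(1 / (n : ℝ)) : ℝ) : EReal) *
      ENNReal.log (iidProb (law 1) n {ω | (c n).guess₂ ω = 0})) atTop ∧
    limsup (fun n : ℕ => ((1 / (n : ℝ) * Real.log (W₁ n) : ℝ) : EReal)) atTop ≤ (R₁ : EReal) ∧
    limsup (fun n : ℕ => ((1 / (n : ℝ) * Real.log (W₂ n) : ℝ) : EReal)) atTop ≤ (R₂ : EReal)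

/-- The error-exponents region `E(R₁, R₂)`. -/
def exponentsRegion (law : Fin 2 → PMF (X × Y₁ × Y₂)) (hbar₁ : Fin 2) (R₁ R₂ : ℝ) : Set (ℝ × ℝ) :=
  closure {θ | Achievable law hbar₁ R₁ R₂ θ.1 θ.2}

/-! ### Auxiliary random variables

Pairs of auxiliaries are given by the joint pmf of `(U, V, X, Y₁, Y₂)`, single ones by the joint
pmf of `(U, X, Y₁)`. -/

/-- The set `S(R₁, R₂)` of auxiliaries `(U, V)` for `(X, Y₁, Y₂) ∼ P`. -/
structure IsAuxPair {U V : Type*} [Fintype U] [Fintype V] (P : PMF (X × Y₁ × Y₂)) (R₁ R₂ : ℝ)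
    (Q : PMF (U × V × X × Y₁ × Y₂)) : Prop where
  marginal : Q.map (fun (_, _, x, y₁, y₂) => (x, y₁, y₂)) = P
  markov_U : IsMarkovChain (Q.map fun (u, _, x, y₁, y₂) => (u, x, (y₁, y₂)))
  markov_V : IsMarkovChain (Q.map fun (u, v, x, y₁, y₂) => (v, (y₁, u), (y₂, x)))
  rate₁ : mutualInfo (Q.map fun (u, _, x, _, _) => (u, x)) ≤ R₁
  rate₂ : condMutualInfo (Q.map fun (u, v, _, y₁, _) => (v, y₁, u)) ≤ R₂

/-- `Qbar` is the joint law of the variables `(Ū, V̄, X̄, Ȳ₁, Ȳ₂)` obtained from the law `Q` of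
`(U, V, X, Y₁, Y₂)` when the law of the observations is replaced by `Pbar`. -/
structure IsTransferPair {U V : Type*} (Pbar : PMF (X × Y₁ × Y₂))
    (Q Qbar : PMF (U × V × X × Y₁ × Y₂)) : Prop where
  marginal : Qbar.map (fun (_, _, x, y₁, y₂) => (x, y₁, y₂)) = Pbar
  cond_U : SameConditional (Qbar.map fun (u, _, x, _, _) => (u, x))
    (Q.map fun (u, _, x, _, _) => (u, x))
  cond_V : SameConditional (Qbar.map fun (u, v, _, y₁, _) => (v, (y₁, u)))
    (Q.map fun (u, v, _, y₁, _) => (v, (y₁, u)))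
  markov_U : IsMarkovChain (Qbar.map fun (u, _, x, y₁, y₂) => (u, x, (y₁, y₂)))
  markov_V : IsMarkovChain (Qbar.map fun (u, v, x, y₁, y₂) => (v, (y₁, u), (x, y₂)))

/-- The set `L₂(UV)`. -/
def L₂ {U V : Type*} (Q : PMF (U × V × X × Y₁ × Y₂)) : Set (PMF (U × V × X × Y₁ × Y₂)) :=
  {T | T.map (fun (u, _, x, _, _) => (u, x)) = Q.map (fun (u, _, x, _, _) => (u, x)) ∧
    T.map (fun (u, v, _, y₁, _) => (u, v, y₁)) = Q.map (fun (u, v, _, y₁, _) => (u, v, y₁)) ∧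
    T.map (fun (u, v, _, _, y₂) => (u, v, y₂)) = Q.map (fun (u, v, _, _, y₂) => (u, v, y₂))}

/-- The set `S(R₁)` of auxiliaries `Ū₁` for `(X̄, Ȳ₁)`, where `(X̄, Ȳ₁, Ȳ₂) ∼ Pbar`. -/
structure IsAuxSingle {U : Type*} [Fintype U] (Pbar : PMF (X × Y₁ × Y₂)) (R₁ : ℝ)
    (Qbar : PMF (U × X × Y₁)) : Prop where
  marginal : Qbar.map (fun (_, x, y₁) => (x, y₁)) = Pbar.map (fun (x, y₁, _) => (x, y₁))
  markov : IsMarkovChain Qbar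
  rate : mutualInfo (Qbar.map fun (u, x, _) => (u, x)) ≤ R₁

/-- `Q` is the joint law of the variables `(U₁, X, Y₁)` obtained from the law `Qbar` of
`(Ū₁, X̄, Ȳ₁)` when the law of the observations is replaced by `P`. -/
structure IsTransferSingle {U : Type*} (P : PMF (X × Y₁ × Y₂))
    (Qbar Q : PMF (U × X × Y₁)) : Prop where
  marginal : Q.map (fun (_, x, y₁) => (x, y₁)) = P.map (fun (x, y₁, _) => (x, y₁))
  cond : SameConditional (Q.map fun (u, x, _) => (u, x)) (Qbar.map fun (u, x, _) => (u, x))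
  markov : IsMarkovChain Q

/-- The set `L̄₁(Ū₁)`. -/
def L₁bar {U : Type*} (Qbar : PMF (U × X × Y₁)) : Set (PMF (U × X × Y₁)) :=
  {T | T.map (fun (u, x, _) => (u, x)) = Qbar.map (fun (u, x, _) => (u, x)) ∧
    T.map (fun (u, _, y₁) => (u, y₁)) = Qbar.map (fun (u, _, y₁) => (u, y₁))}

/-- The nonnegative `θ₁` satisfying the bound on the first exponent for some `Ū₁ ∈ S(R₁)`. -/
def thetaSet₁ (P Pbar : PMF (X × Y₁ × Y₂)) (R₁ : ℝ) : Set ℝ :=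
  {θ₁ | 0 ≤ θ₁ ∧ ∃ (U : Type) (_ : Fintype U) (Qbar Q : PMF (U × X × Y₁)),
    IsAuxSingle Pbar R₁ Qbar ∧ IsTransferSingle P Qbar Q ∧
    ENNReal.ofReal θ₁ ≤ ⨅ T ∈ L₁bar Qbar, relEntropy T Q}

/-- The nonnegative `θ₂` satisfying the bound on the second exponent for some
`(U, V) ∈ S(R₁, R₂)`. -/
def thetaSet₂ (P Pbar : PMF (X × Y₁ × Y₂)) (R₁ R₂ : ℝ) : Set ℝ :=
  {θ₂ | 0 ≤ θ₂ ∧ ∃ (U V : Type) (_ : Fintype U) (_ : Fintype V)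
    (Q Qbar : PMF (U × V × X × Y₁ × Y₂)),
    IsAuxPair P R₁ R₂ Q ∧ IsTransferPair Pbar Q Qbar ∧
    ENNReal.ofReal θ₂ ≤ ⨅ T ∈ L₂ Q, relEntropy T Qbar}

end Codes

end ConcurrentDetection

end

/-! Each detector runs its own quantize-and-test scheme: Detector 1 a one-layer scheme matched to
`Pbar` that accepts hypothesis 1, Detector 2 a two-layer scheme matched to `P` that accepts
hypothesis 0. The sensor encodes for a scheme only when its sequence is typical for the `X`-marginal
of that scheme. As these marginals differ, for a small parameter no sequence is typical for both. So
one link carries the disjoint union of the two index sets and a failure symbol, which costs a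
constant factor and no rate (`exists_code`, `eventually_exists_code`). This is why there is no
tradeoff.

Error at the matched law. Codewords are drawn independently, and a word is used when it is jointly
typical with the observation. By the covering inequality `one_sub_pow_le`, slightly more than `exp
(n I)` words fail to cover only with vanishing probability. A word chosen by the first layer must
also work for the second layer and for the final test. Instead of a Markov lemma, all words are
controlled at once: a change of measure bounds the expected number of bad words by the probability
of atypicality under the joint law, times a factor `exp (O(δ n))`, where `δ` is the parameter of the
earlier layer (`exists_two_layer_codebook`). Atypicality is exponentially unlikely
(`seqWeight_not_typical`), so the factor is harmless when each layer has a much smaller parameter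
than the next test (`TestChannel.exists_scheme`).

Error at the other law. For a fixed pair of codewords of joint type `T_UV` and i.i.d. letters of law
`p`, the joint type `T` has probability at most `exp (-n D(T ‖ T_UV ⊗ p))` (`sum_freq_eq_le`).
Acceptance forces the marginals of `T` to be close to the prescribed ones, where compactness gives
the exponent up to `ε` (`exists_pos_condDiv`). A union bound over all pairs of codewords costs `exp
(n (I₁ + I₂))`, and this is exactly compensated, because `D(T ‖ T_UV ⊗ p) = D(T ‖ qbar) + I₁ + I₂`
for the relevant `T` (`TestChannel.sum_log_eq`).

Letting the tolerance tend to zero along the blocklength (`exists_tendsto_zero`) makes the pair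
achievable itself, not merely a limit of achievable pairs. -/

noncomputable section

namespace ConcurrentDetection

/-! ### Marginals, empirical distributions and typical sequences -/

section Marginals

variable {A B S : Type*} [Fintype A] [Fintype B]

open scoped Classical in
/-- The image of the weight function `q` under `π`. -/
def marg (q : A → ℝ) (π : A → S) (s : S) : ℝ := ∑ a, if π a = s then q a else 0

lemma marg_nonneg {q : A → ℝ} (hq : ∀ a, 0 ≤ q a) (π : A → S) (s : S) : 0 ≤ marg q π s :=
  Finset.sum_nonneg fun a _ => by split_ifs <;> simp [hq a]

lemma le_marg {q : A → ℝ} (hq : ∀ a, 0 ≤ q a) (π : A → S) (a : A) : q a ≤ marg q π (π a) := by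
  classical
  have h := Finset.single_le_sum (f := fun a' => if π a' = π a then q a' else 0)
    (fun a' _ => by split_ifs <;> simp [hq a']) (Finset.mem_univ a)
  simpa [marg] using h

lemma sum_marg_mul [Fintype S] (q : A → ℝ) (π : A → S) (f : S → ℝ) :
    ∑ s, marg q π s * f s = ∑ a, q a * f (π a) := by
  classical
  simp only [marg, Finset.sum_mul]
  rw [Finset.sum_comm]
  refine Finset.sum_congr rfl fun a _ => ?_
  simp [ite_mul]

lemma sum_marg [Fintype S] (q : A → ℝ) (π : A → S) : ∑ s, marg q π s = ∑ a, q a := by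
  simpa using sum_marg_mul q π fun _ => 1

lemma marg_marg (q : A → ℝ) (π : A → B) (ρ : B → S) (s : S) :
    marg (marg q π) ρ s = marg q (fun a => ρ (π a)) s := by
  classical
  have := sum_marg_mul q π fun b => if ρ b = s then 1 else 0
  simpa [marg, mul_ite] using this

/-- The empirical distribution of a finite sequence. -/
def freq {n : ℕ} {S : Type*} (ω : Fin n → S) : S → ℝ := marg (fun _ => 1 / (n : ℝ)) ω

lemma freq_nonneg {n : ℕ} (ω : Fin n → S) (s : S) : 0 ≤ freq ω s :=
  marg_nonneg (fun _ => by positivity) _ _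

lemma sum_freq [Fintype S] {n : ℕ} (hn : n ≠ 0) (ω : Fin n → S) : ∑ s, freq ω s = 1 := by
  rw [freq, sum_marg]
  simp [hn]

lemma sum_freq_mul [Fintype S] {n : ℕ} (hn : n ≠ 0) (ω : Fin n → S) (f : S → ℝ) :
    n * ∑ s, freq ω s * f s = ∑ t, f (ω t) := by
  rw [freq, sum_marg_mul, Finset.mul_sum]
  refine Finset.sum_congr rfl fun t _ => ?_
  have : (n : ℝ) ≠ 0 := by exact_mod_cast hn
  field_simp

lemma freq_comp {n : ℕ} (ω : Fin n → B) (ρ : B → S) (s : S) :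
    freq (fun t => ρ (ω t)) s = marg (freq ω) ρ s := (marg_marg _ _ _ _).symm

lemma freq_pos {n : ℕ} (ω : Fin n → S) (t : Fin n) : 0 < freq ω (ω t) := by
  refine lt_of_lt_of_le ?_ (le_marg (q := fun _ => 1 / (n : ℝ)) (fun _ => by positivity) ω t)
  have : 0 < n := t.pos
  positivity

/-- Robust typicality of a sequence for the weight function `q`. -/
def IsTypical {n : ℕ} {S : Type*} (δ : ℝ) (q : S → ℝ) (ω : Fin n → S) : Prop :=
  ∀ s, |freq ω s - q s| ≤ δ * q s

/-- The tolerance is proportional to `q s`, so a letter of weight zero has frequency zero. This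
keeps logarithms of densities finite along typical sequences. -/
lemma IsTypical.pos {n : ℕ} {δ : ℝ} {q : S → ℝ} (hq : ∀ s, 0 ≤ q s) {ω : Fin n → S}
    (h : IsTypical δ q ω) (t : Fin n) : 0 < q (ω t) := by
  refine lt_of_le_of_ne (hq _) fun h0 => ?_
  have h1 := h (ω t)
  rw [← h0] at h1
  have h2 := freq_pos ω t
  simp at h1
  linarith

/-- Relative errors add up over a fibre exactly as the weights do, so nothing is lost in `δ`. -/
lemma IsTypical.map {n : ℕ} {δ : ℝ} {q : B → ℝ} {ω : Fin n → B}
    (h : IsTypical δ q ω) (ρ : B → S) : IsTypical δ (marg q ρ) fun t => ρ (ω t) := by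
  classical
  intro s
  rw [freq_comp, marg, marg, ← Finset.sum_sub_distrib, Finset.mul_sum]
  refine (Finset.abs_sum_le_sum_abs _ _).trans (Finset.sum_le_sum fun b _ => ?_)
  split_ifs
  · exact h b
  · simp

lemma IsTypical.mono {n : ℕ} {δ δ' : ℝ} {q : S → ℝ} (hq : ∀ s, 0 ≤ q s) {ω : Fin n → S}
    (h : IsTypical δ q ω) (hδ : δ ≤ δ') : IsTypical δ' q ω := fun s =>
  (h s).trans (mul_le_mul_of_nonneg_right hδ (hq s))

lemma IsTypical.abs_sum_sub_le [Fintype S] {n : ℕ} (hn : n ≠ 0) {δ : ℝ} {q : S → ℝ} {ω : Fin n → S}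
    (h : IsTypical δ q ω) (f : S → ℝ) :
    |∑ t, f (ω t) - n * ∑ s, q s * f s| ≤ n * (δ * ∑ s, q s * |f s|) := by
  rw [← sum_freq_mul hn, ← mul_sub, ← Finset.sum_sub_distrib, abs_mul, Nat.abs_cast,
    Finset.mul_sum]
  refine mul_le_mul_of_nonneg_left ?_ (Nat.cast_nonneg n)
  refine (Finset.abs_sum_le_sum_abs _ _).trans (Finset.sum_le_sum fun s _ => ?_)
  rw [← sub_mul, abs_mul, ← mul_assoc]
  exact mul_le_mul_of_nonneg_right (h s) (abs_nonneg _)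

end Marginals

/-! ### Sums over product sequences and exponential concentration -/

section Concentration

variable {A B S : Type*} [Fintype A] [Fintype B] [Fintype S]

lemma sum_fun_prod {n : ℕ} (F : (Fin n → A × B) → ℝ) :
    ∑ ω, F ω = ∑ a : Fin n → A, ∑ b : Fin n → B, F fun t => (a t, b t) := by
  classical
  rw [← Fintype.sum_prod_type']
  exact Fintype.sum_equiv (Equiv.arrowProdEquivProdArrow (Fin n) (fun _ => A) (fun _ => B)) _ _
    fun ω => rfl

lemma sum_prod_fun {n : ℕ} (F : Fin n → A → ℝ) :
    ∑ ω : Fin n → A, ∏ t, F t (ω t) = ∏ t, ∑ a, F t a := by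
  classical
  rw [Finset.prod_univ_sum, Fintype.piFinset_univ]

open scoped Classical in
/-- The total weight of the sequences in `E` under the product of the weights `q`. -/
def seqWeight (q : A → ℝ) (n : ℕ) (E : (Fin n → A) → Prop) : ℝ :=
  ∑ ω : Fin n → A, if E ω then ∏ t, q (ω t) else 0

lemma seqWeight_nonneg {q : A → ℝ} (hq : ∀ a, 0 ≤ q a) (n : ℕ) (E : (Fin n → A) → Prop) :
    0 ≤ seqWeight q n E :=
  Finset.sum_nonneg fun ω _ => by
    split_ifs
    · exact Finset.prod_nonneg fun t _ => hq _
    · exact le_rfl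

lemma seqWeight_mono {q : A → ℝ} (hq : ∀ a, 0 ≤ q a) (n : ℕ) {E F : (Fin n → A) → Prop}
    (h : ∀ ω, E ω → F ω) : seqWeight q n E ≤ seqWeight q n F :=
  Finset.sum_le_sum fun ω _ => by
    have := Finset.prod_nonneg fun t (_ : t ∈ Finset.univ) => hq (ω t)
    by_cases hE : E ω
    · simp [hE, h ω hE]
    · simp only [hE, if_false]; split_ifs <;> simp [this]

lemma seqWeight_exists_le {ι : Type*} [Fintype ι] {q : A → ℝ} (hq : ∀ a, 0 ≤ q a) (n : ℕ)
    (E : ι → (Fin n → A) → Prop) :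
    seqWeight q n (fun ω => ∃ i, E i ω) ≤ ∑ i, seqWeight q n (E i) := by
  classical
  unfold seqWeight
  rw [Finset.sum_comm]
  refine Finset.sum_le_sum fun ω _ => ?_
  have h0 := Finset.prod_nonneg fun t (_ : t ∈ Finset.univ) => hq (ω t)
  have h1 : ∀ i ∈ Finset.univ, 0 ≤ if E i ω then ∏ t, q (ω t) else 0 := fun i _ => by
    split_ifs <;> simp [h0]
  split_ifs with h
  · obtain ⟨i, hi⟩ := h
    refine le_trans ?_ (Finset.single_le_sum h1 (Finset.mem_univ i))
    simp [hi]
  · exact Finset.sum_nonneg h1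

/-- Chernoff bound for bounded centred letters. -/
lemma seqWeight_chernoff {q : A → ℝ} (hq : ∀ a, 0 ≤ q a) (hq1 : ∑ a, q a = 1) {g : A → ℝ}
    (hg : ∀ a, |g a| ≤ 1) (hg0 : ∑ a, q a * g a = 0) {ε : ℝ} (hε : 0 ≤ ε) (hε1 : ε ≤ 1) (n : ℕ) :
    seqWeight q n (fun ω => n * ε ≤ ∑ t, g (ω t)) ≤ Real.exp (-(ε ^ 2 / 4) * n) := by
  classical
  -- Tilting by `ε / 2`, together with `exp x ≤ 1 + x + x²` for `|x| ≤ 1`, gives the exponent `-ε²/2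
  -- + ε²/4 = -ε²/4`.
  have hmgf : ∑ a, q a * Real.exp (ε / 2 * g a) ≤ Real.exp ((ε / 2) ^ 2) := by
    calc ∑ a, q a * Real.exp (ε / 2 * g a)
        ≤ ∑ a, (q a + ε / 2 * (q a * g a) + (ε / 2) ^ 2 * q a) := by
          refine Finset.sum_le_sum fun a _ => ?_
          have h1 := abs_le.1 (hg a)
          have hx : |ε / 2 * g a| ≤ 1 := by
            rw [abs_mul, abs_of_nonneg (by positivity)]
            nlinarith [hg a, abs_nonneg (g a)]
          have h2 := (abs_le.1 (Real.abs_exp_sub_one_sub_id_le hx)).2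
          have h3 : (ε / 2 * g a) ^ 2 ≤ (ε / 2) ^ 2 := by
            rw [mul_pow]
            have : g a ^ 2 ≤ 1 := by nlinarith
            nlinarith [sq_nonneg (ε / 2)]
          have := mul_le_mul_of_nonneg_left (show Real.exp (ε / 2 * g a) ≤
            1 + ε / 2 * g a + (ε / 2) ^ 2 by linarith) (hq a)
          linarith
      _ = 1 + (ε / 2) ^ 2 := by
          rw [Finset.sum_add_distrib, Finset.sum_add_distrib, ← Finset.mul_sum, ← Finset.mul_sum,
            hg0, hq1]; ring
      _ ≤ _ := by linarith [Real.add_one_le_exp ((ε / 2) ^ 2)]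
  calc seqWeight q n (fun ω => n * ε ≤ ∑ t, g (ω t))
      ≤ ∑ ω : Fin n → A, Real.exp (-(ε / 2 * (n * ε))) *
          ∏ t, (q (ω t) * Real.exp (ε / 2 * g (ω t))) := by
        refine Finset.sum_le_sum fun ω _ => ?_
        have h0 := Finset.prod_nonneg fun t (_ : t ∈ Finset.univ) => hq (ω t)
        rw [Finset.prod_mul_distrib, ← Real.exp_sum, ← Finset.mul_sum, mul_left_comm,
          ← Real.exp_add]
        split_ifs with h
        · refine le_mul_of_one_le_right h0 (Real.one_le_exp ?_)
          nlinarith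
        · positivity
    _ = Real.exp (-(ε / 2 * (n * ε))) * (∑ a, q a * Real.exp (ε / 2 * g a)) ^ n := by
        rw [← Finset.mul_sum, sum_prod_fun fun _ a => q a * Real.exp (ε / 2 * g a)]
        simp
    _ ≤ Real.exp (-(ε / 2 * (n * ε))) * Real.exp ((ε / 2) ^ 2) ^ n := by
        gcongr
        exact Finset.sum_nonneg fun a _ => mul_nonneg (hq a) (Real.exp_nonneg _)
    _ = _ := by
        rw [← Real.exp_nat_mul, ← Real.exp_add]
        congr 1; ring

/-- Sequences of independent letters are atypical with exponentially small probability. -/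
lemma seqWeight_not_typical {q : A → ℝ} (hq : ∀ a, 0 ≤ q a) (hq1 : ∑ a, q a = 1) (π : A → S)
    {δ : ℝ} (hδ : 0 < δ) :
    ∃ c, 0 < c ∧ ∀ n : ℕ, n ≠ 0 →
      seqWeight q n (fun ω => ¬ IsTypical δ (marg q π) fun t => π (ω t)) ≤
        2 * Fintype.card S * Real.exp (-c * n) := by
  classical
  have key : ∀ s : S, ∀ᶠ c in nhdsWithin (0 : ℝ) (Set.Ioi 0), ∀ n : ℕ, n ≠ 0 →
      seqWeight q n (fun ω => ¬ |freq (fun t => π (ω t)) s - marg q π s| ≤ δ * marg q π s) ≤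
        2 * Real.exp (-c * n) := by
    intro s
    have hm0 := marg_nonneg hq π s
    rcases hm0.eq_or_lt with h0 | hpos
    -- A letter of weight zero: any sequence in which it occurs has product weight zero.
    · refine Eventually.of_forall fun c n _ => le_trans (le_of_eq ?_)
        (by positivity : 0 ≤ 2 * Real.exp (-c * n))
      unfold seqWeight
      refine Finset.sum_eq_zero fun ω _ => ?_
      split_ifs with h
      · by_contra hne
        apply h
        have : freq (fun t => π (ω t)) s = 0 := by
          rw [freq, marg]
          refine Finset.sum_eq_zero fun t _ => ?_
          rw [if_neg]
          intro ht
          apply hne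
          refine Finset.prod_eq_zero (Finset.mem_univ t) (le_antisymm ?_ (hq _))
          have := le_marg hq π (ω t)
          rwa [ht, ← h0] at this
        simp [this, ← h0]
      · rfl
    · set ε := min 1 (δ * marg q π s) with hε
      have hε0 : 0 < ε := lt_min one_pos (mul_pos hδ hpos)
      have hm1 : marg q π s ≤ 1 := by
        rw [← hq1, ← sum_marg q π]
        exact Finset.single_le_sum (fun s _ => marg_nonneg hq π s) (Finset.mem_univ s)
      set g : A → ℝ := fun a => (if π a = s then 1 else 0) - marg q π s with hg
      have hg1 : ∀ a, |g a| ≤ 1 := fun a => by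
        simp only [hg]; split_ifs <;> rw [abs_le] <;> constructor <;> linarith
      have hg0 : ∑ a, q a * g a = 0 := by
        simp only [hg, mul_sub, Finset.sum_sub_distrib, ← Finset.sum_mul, hq1, mul_ite, mul_one,
          mul_zero, one_mul]
        simp [marg]
      filter_upwards [Ioc_mem_nhdsGT (show 0 < ε ^ 2 / 4 by positivity)] with c hc n hn
      have hn' : (0 : ℝ) < n := by positivity
      have hfreq : ∀ ω : Fin n → A, ∑ t, g (ω t) =
          n * (freq (fun t => π (ω t)) s - marg q π s) := fun ω => by
        simp only [hg, Finset.sum_sub_distrib, Finset.sum_const, Finset.card_univ,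
          Fintype.card_fin, nsmul_eq_mul, mul_sub]
        congr 1
        rw [freq, marg, Finset.mul_sum]
        refine Finset.sum_congr rfl fun t _ => ?_
        split_ifs
        · field_simp
        · simp
      have h1 := seqWeight_chernoff hq hq1 hg1 hg0 hε0.le (min_le_left _ _) n
      have h2 := seqWeight_chernoff hq hq1 (g := fun a => -g a) (by simpa using hg1)
        (by simpa using hg0) hε0.le (min_le_left _ _) n
      have h3 : Real.exp (-(ε ^ 2 / 4) * n) ≤ Real.exp (-c * n) := by
        gcongr; exact hc.2
      have h4 : seqWeight q n
            (fun ω => ¬ |freq (fun t => π (ω t)) s - marg q π s| ≤ δ * marg q π s) ≤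
          ∑ b : Bool, seqWeight q n (fun ω => if b then n * ε ≤ ∑ t, g (ω t)
            else n * ε ≤ ∑ t, -g (ω t)) := by
        refine le_trans (seqWeight_mono hq n fun ω hω => ?_) (seqWeight_exists_le hq n _)
        rw [not_le, lt_abs] at hω
        have h5 : ε ≤ δ * marg q π s := min_le_right _ _
        rcases hω with hω | hω
        · refine ⟨true, ?_⟩
          simp only [if_true, hfreq]
          gcongr; linarith
        · refine ⟨false, ?_⟩
          simp only [Bool.false_eq_true, if_false, Finset.sum_neg_distrib, hfreq, ← mul_neg]
          gcongr; linarith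
      simp only [Fintype.sum_bool, if_true, Bool.false_eq_true, if_false] at h4
      linarith
  obtain ⟨c, hc, hc0⟩ := ((eventually_all.2 key).and self_mem_nhdsWithin).exists
  refine ⟨c, hc0, fun n hn => ?_⟩
  have := seqWeight_exists_le hq n
    (fun (s : S) ω => ¬ |freq (fun t => π (ω t)) s - marg q π s| ≤ δ * marg q π s)
  simp only [IsTypical, not_forall]
  refine this.trans ((Finset.sum_le_sum fun s _ => hc s n hn).trans (le_of_eq ?_))
  simp; ring

end Concentration

/-! ### Covering with a two-layer random codebook -/

section Covering

variable {A B : Type*} [Fintype A] [Fintype B]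

lemma exists_le_of_weighted_sum_le {w J : A → ℝ} (hw : ∀ a, 0 ≤ w a) (hw1 : ∑ a, w a = 1) {R : ℝ}
    (h : ∑ a, w a * J a ≤ R) : ∃ a, J a ≤ R := by
  by_contra! hJ
  have h0 : ∑ a, w a * (J a - R) ≤ 0 := by
    simp only [mul_sub, Finset.sum_sub_distrib, ← Finset.sum_mul, hw1]; linarith
  have hnn : ∀ a ∈ Finset.univ, 0 ≤ w a * (J a - R) := fun a _ =>
    mul_nonneg (hw a) (sub_nonneg.2 (hJ a).le)
  have h1 := (Finset.sum_eq_zero_iff_of_nonneg hnn).1 (le_antisymm h0 (Finset.sum_nonneg hnn))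
  have h2 : ∀ a, w a = 0 := fun a => by
    rcases mul_eq_zero.1 (h1 a (Finset.mem_univ a)) with h | h
    · exact h
    · exact absurd h (sub_pos.2 (hJ a)).ne'
  simp [h2] at hw1

lemma sum_prod_mul_apply {w : A → ℝ} (hw1 : ∑ a, w a = 1) {M : ℕ} (h : A → ℝ) (j : Fin M) :
    ∑ a : Fin M → A, (∏ i, w (a i)) * h (a j) = ∑ a, w a * h a := by
  classical
  have : ∀ a : Fin M → A, (∏ i, w (a i)) * h (a j) =
      ∏ i, (w (a i) * if i = j then h (a i) else 1) := fun a => by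
    rw [Finset.prod_mul_distrib, Finset.prod_ite_eq' Finset.univ j]
    simp
  simp only [this]
  rw [sum_prod_fun fun i a => w a * if i = j then h a else 1]
  have h2 : ∀ i : Fin M, (∑ a, w a * if i = j then h a else 1) =
      if i = j then ∑ a, w a * h a else 1 := fun i => by split_ifs <;> simp [hw1]
  rw [Finset.prod_congr rfl fun i _ => h2 i]
  simp

open scoped Classical in
/-- Some codebook is at least as good as the average over random codebooks with independent
codewords of law `w`, for the sum of the covering failure and of a total cost. -/
lemma exists_codebook {w : A → ℝ} (hw : ∀ a, 0 ≤ w a) (hw1 : ∑ a, w a = 1) (p : B → ℝ)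
    (E : A → B → Prop) (k : A → B → ℝ) (M : ℕ) :
    ∃ a : Fin M → A,
      (∑ b, p b * if ∀ i, ¬ E (a i) b then 1 else 0) + ∑ i, ∑ b, p b * k (a i) b ≤
      ∑ b, p b * (1 - ∑ a, if E a b then w a else 0) ^ M + M * ∑ a, w a * ∑ b, p b * k a b := by
  refine exists_le_of_weighted_sum_le (w := fun a : Fin M → A => ∏ i, w (a i))
    (fun a => Finset.prod_nonneg fun i _ => hw _) ?_ (le_of_eq ?_)
  · rw [sum_prod_fun fun _ a => w a]; simp [hw1]
  simp only [mul_add, Finset.sum_add_distrib]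
  congr 1
  · simp only [Finset.mul_sum]
    rw [Finset.sum_comm]
    refine Finset.sum_congr rfl fun b _ => ?_
    -- The event that every codeword misses `b` is a product over the codewords, whence the `M`-th
    -- power.
    have h1 : ∀ a : Fin M → A, (∏ i, w (a i)) * (p b * if ∀ i, ¬ E (a i) b then 1 else 0) =
        p b * ∏ i, if E (a i) b then 0 else w (a i) := fun a => by
      rw [mul_left_comm]
      congr 1
      by_cases h : ∀ i, ¬ E (a i) b
      · simp [h]
      · obtain ⟨i, hi⟩ := not_forall_not.1 h
        rw [if_neg h, mul_zero, Finset.prod_eq_zero (Finset.mem_univ i)]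
        simp [hi]
    simp only [h1]
    rw [← Finset.mul_sum, sum_prod_fun fun _ a => if E a b then 0 else w a]
    have h2 : (∑ a, if E a b then 0 else w a) = 1 - ∑ a, if E a b then w a else 0 := by
      rw [eq_sub_iff_add_eq, ← Finset.sum_add_distrib, ← hw1]
      exact Finset.sum_congr rfl fun a _ => by split_ifs <;> simp
    simp [h2]
  · have h3 : ∀ a : Fin M → A, (∏ i, w (a i)) * ∑ i, ∑ b, p b * k (a i) b =
        ∑ i, (∏ i, w (a i)) * ∑ b, p b * k (a i) b := fun a => Finset.mul_sum _ _ _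
    simp only [h3]
    rw [Finset.sum_comm]
    simp only [sum_prod_mul_apply hw1 fun a => ∑ b, p b * k a b]
    simp

/-- Convexity: on the segment from `-t` to `0` the exponential lies below its chord. -/
lemma exp_neg_mul_le {s t : ℝ} (hs : 0 ≤ s) (hs1 : s ≤ 1) :
    Real.exp (-(t * s)) ≤ 1 - s + Real.exp (-t) := by
  have h := convexOn_exp.2 (Set.mem_univ 0) (Set.mem_univ (-t)) (sub_nonneg.2 hs1) hs (by ring)
  simp only [smul_eq_mul, mul_zero, zero_add, Real.exp_zero, mul_one] at h
  have : s * Real.exp (-t) ≤ Real.exp (-t) := mul_le_of_le_one_left (Real.exp_nonneg _) hs1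
  have h2 : s * -t = -(t * s) := by ring
  rw [h2] at h
  linarith

/-- The covering inequality of rate-distortion theory. In its use `x` is the probability that an
independent codeword fits, `s` the conditional probability of fitting under the joint law, and `t`
the number of codewords relative to the maximal density. -/
lemma one_sub_pow_le {x s t : ℝ} {M : ℕ} (hx1 : x ≤ 1) (hs : 0 ≤ s) (hs1 : s ≤ 1)
    (h : t * s ≤ M * x) : (1 - x) ^ M ≤ 1 - s + Real.exp (-t) := by
  refine le_trans ?_ (exp_neg_mul_le hs hs1)
  calc (1 - x) ^ M ≤ Real.exp (-x) ^ M := by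
        refine pow_le_pow_left₀ (by linarith) ?_ _
        linarith [Real.add_one_le_exp (-x)]
    _ = Real.exp (-(M * x)) := by rw [← Real.exp_nat_mul]; congr 1; ring
    _ ≤ _ := by gcongr

variable {U V O : Type*} [Fintype U] [Fintype V] [Fintype O]

open scoped Classical in
/-- One-layer step: `q` is a joint weight on `U × O` whose density with respect to `w ⊗ p` is at
most `H` on `E`. -/
lemma sum_mul_one_sub_pow_le {w : U → ℝ} (hw : ∀ u, 0 ≤ w u) (hw1 : ∑ u, w u = 1)
    {q : U → O → ℝ} (hq : ∀ u o, 0 ≤ q u o) {E : U → O → Prop} {H : ℝ} (hH : 0 < H)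
    (hE : ∀ u o, E u o → q u o ≤ H * (w u * ∑ u', q u' o)) (M : ℕ) :
    ∑ o, (∑ u, q u o) * (1 - ∑ u, if E u o then w u else 0) ^ M ≤
      (∑ o, ∑ u, if E u o then 0 else q u o) + (∑ o, ∑ u, q u o) * Real.exp (-(M / H)) := by
  rw [Finset.sum_mul, ← Finset.sum_add_distrib]
  refine Finset.sum_le_sum fun o _ => ?_
  set P := ∑ u, q u o with hP
  have hP0 : 0 ≤ P := Finset.sum_nonneg fun u _ => hq u o
  set x := ∑ u, if E u o then w u else 0 with hx
  set g := ∑ u, if E u o then q u o else 0 with hg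
  have hg0 : 0 ≤ g := Finset.sum_nonneg fun u _ => by split_ifs <;> simp [hq]
  have hsplit : g + (∑ u, if E u o then 0 else q u o) = P := by
    rw [hg, hP, ← Finset.sum_add_distrib]
    exact Finset.sum_congr rfl fun u _ => by split_ifs <;> simp
  have hb0 : 0 ≤ ∑ u, if E u o then 0 else q u o :=
    Finset.sum_nonneg fun u _ => by split_ifs <;> simp [hq]
  rcases hP0.eq_or_lt with h0 | hpos
  · rw [← h0]; simpa using hb0
  have hx1 : x ≤ 1 := by
    rw [← hw1]
    exact Finset.sum_le_sum fun u _ => by split_ifs <;> simp [hw]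
  have hgx : g ≤ H * (x * P) := by
    rw [hg, hx, Finset.sum_mul, Finset.mul_sum]
    refine Finset.sum_le_sum fun u _ => ?_
    split_ifs with h
    · exact hE u o h
    · simp
  -- `g / P` is the conditional probability of `E` given `o`; the density bound makes it at most `H
  -- * x`.
  have h := one_sub_pow_le (M := M) (s := g / P) (t := M / H) hx1 (by positivity)
    ((div_le_one hpos).2 (by linarith)) (by
      rw [div_mul_div_comm, div_le_iff₀ (by positivity)]
      have := mul_le_mul_of_nonneg_left hgx (Nat.cast_nonneg (α := ℝ) M)
      linarith)
  calc P * (1 - x) ^ M ≤ P * (1 - g / P + Real.exp (-(M / H))) := by gcongr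
    _ = P - g + P * Real.exp (-(M / H)) := by field_simp
    _ = _ := by rw [← hsplit]; ring

open scoped Classical in
/-- Two-layer covering. The weight `q` on `U × V × O` has marginals `∑ v, q u v o` and
`∑ u, ∑ v, q u v o`; the density of the first layer is between `Lo₁` and `Hi₁` on `E₁`, that of the
second layer between `Lo₂` and `Hi₂` on `E₂`. -/
theorem exists_two_layer_codebook {wU : U → ℝ} {wV : U → V → ℝ} (hwU : ∀ u, 0 ≤ wU u)
    (hwU1 : ∑ u, wU u = 1) (hwV : ∀ u v, 0 ≤ wV u v) (hwV1 : ∀ u, ∑ v, wV u v = 1)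
    {q : U → V → O → ℝ} (hq : ∀ u v o, 0 ≤ q u v o) (hq1 : ∑ o, ∑ u, ∑ v, q u v o = 1)
    {E₁ : U → O → Prop} {E₂ G : U → V → O → Prop} {Lo₁ Hi₁ Lo₂ Hi₂ : ℝ}
    (hL₁ : 0 < Lo₁) (hH₁ : 0 < Hi₁) (hL₂ : 0 < Lo₂) (hH₂ : 0 < Hi₂)
    (hE₁L : ∀ u o, E₁ u o → Lo₁ * (wU u * ∑ u', ∑ v, q u' v o) ≤ ∑ v, q u v o)
    (hE₁H : ∀ u o, E₁ u o → ∑ v, q u v o ≤ Hi₁ * (wU u * ∑ u', ∑ v, q u' v o))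
    (hE₂L : ∀ u v o, E₂ u v o → Lo₂ * (wV u v * ∑ v', q u v' o) ≤ q u v o)
    (hE₂H : ∀ u v o, E₂ u v o → q u v o ≤ Hi₂ * (wV u v * ∑ v', q u v' o)) (M₁ M₂ : ℕ) :
    ∃ (cu : Fin M₁ → U) (cv : Fin M₁ → Fin M₂ → V),
      (∑ o, if (∀ i, ¬ E₁ (cu i) o) ∨ ∃ i, E₁ (cu i) o ∧ ((∀ j, ¬ E₂ (cu i) (cv i j) o) ∨
          ∃ j, E₂ (cu i) (cv i j) o ∧ ¬ G (cu i) (cv i j) o)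
        then ∑ u, ∑ v, q u v o else 0) ≤
      (∑ o, ∑ u, if E₁ u o then 0 else ∑ v, q u v o) + Real.exp (-(M₁ / Hi₁)) +
      M₁ / Lo₁ * ((∑ o, ∑ u, ∑ v, if E₂ u v o then 0 else q u v o) + Real.exp (-(M₂ / Hi₂)) +
        M₂ / Lo₂ * ∑ o, ∑ u, ∑ v, if G u v o then 0 else q u v o) := by
  set q₁ : U → O → ℝ := fun u o => ∑ v, q u v o with hq₁
  set p : O → ℝ := fun o => ∑ u, q₁ u o with hp
  have hq₁0 : ∀ u o, 0 ≤ q₁ u o := fun u o => Finset.sum_nonneg fun v _ => hq u v o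
  have hp0 : ∀ o, 0 ≤ p o := fun o => Finset.sum_nonneg fun u _ => hq₁0 u o
  -- second layer, for each word of the first layer
  set p₂ : U → O → ℝ := fun u o => p o * if E₁ u o then 1 else 0 with hp₂
  have hp₂0 : ∀ u o, 0 ≤ p₂ u o := fun u o => mul_nonneg (hp0 o) (by split_ifs <;> simp)
  set K₂ : U → V → O → ℝ := fun u v o => if E₂ u v o ∧ ¬ G u v o then 1 else 0 with hK₂
  have layer₂ : ∀ u, ∃ cv : Fin M₂ → V, _ := fun u =>
    exists_codebook (hwV u) (hwV1 u) (p₂ u) (E₂ u) (K₂ u) M₂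
  choose cv hcv using layer₂
  -- The second-layer book depends on the word `u` and not on its index, so it can be fixed before
  -- the first layer is drawn. The cost of `u` is then the second-layer failure averaged over random
  -- books. Once summed over `o`, it dominates the failure of the chosen book `cv u`.
  set k : U → O → ℝ := fun u o => (if E₁ u o then 1 else 0) *
    ((1 - ∑ v, if E₂ u v o then wV u v else 0) ^ M₂ + M₂ * ∑ v, wV u v * K₂ u v o) with hk
  obtain ⟨cu, hcu⟩ := exists_codebook hwU hwU1 p E₁ k M₁
  refine ⟨cu, fun i => cv (cu i), ?_⟩
  have hk2 : ∀ u, ∑ o, p o * k u o = ∑ o, p₂ u o * (1 - ∑ v, if E₂ u v o then wV u v else 0) ^ M₂ +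
      M₂ * ∑ v, wV u v * ∑ o, p₂ u o * K₂ u v o := fun u => by
    have : ∑ v, wV u v * ∑ o, p₂ u o * K₂ u v o = ∑ o, p₂ u o * ∑ v, wV u v * K₂ u v o := by
      simp only [Finset.mul_sum]
      rw [Finset.sum_comm]
      exact Finset.sum_congr rfl fun o _ => Finset.sum_congr rfl fun v _ => by ring
    rw [this, Finset.mul_sum, ← Finset.sum_add_distrib]
    refine Finset.sum_congr rfl fun o _ => ?_
    simp only [hk, hp₂]; ring
  -- the failure probability of the codebook
  have hfail : (∑ o, if (∀ i, ¬ E₁ (cu i) o) ∨ ∃ i, E₁ (cu i) o ∧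
        ((∀ j, ¬ E₂ (cu i) (cv (cu i) j) o) ∨
          ∃ j, E₂ (cu i) (cv (cu i) j) o ∧ ¬ G (cu i) (cv (cu i) j) o) then p o else 0) ≤
      (∑ o, p o * if ∀ i, ¬ E₁ (cu i) o then 1 else 0) + ∑ i, ∑ o, p o * k (cu i) o := by
    have h1 : ∀ u, (∑ o, p₂ u o * if ∀ j, ¬ E₂ u (cv u j) o then 1 else 0) +
        ∑ j, ∑ o, p₂ u o * K₂ u (cv u j) o ≤ ∑ o, p o * k u o := fun u => by
      rw [hk2]; exact hcv u
    refine le_trans ?_ (add_le_add le_rfl (Finset.sum_le_sum fun i _ => h1 (cu i)))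
    have h2 : ∀ i : Fin M₁, (∑ o, p₂ (cu i) o * if ∀ j, ¬ E₂ (cu i) (cv (cu i) j) o then 1 else 0) +
        ∑ j, ∑ o, p₂ (cu i) o * K₂ (cu i) (cv (cu i) j) o = ∑ o, p₂ (cu i) o *
          ((if ∀ j, ¬ E₂ (cu i) (cv (cu i) j) o then 1 else 0) +
            ∑ j, K₂ (cu i) (cv (cu i) j) o) := fun i => by
      rw [Finset.sum_comm, ← Finset.sum_add_distrib]
      exact Finset.sum_congr rfl fun o _ => by rw [mul_add, Finset.mul_sum]
    simp only [h2]
    rw [Finset.sum_comm, ← Finset.sum_add_distrib]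
    refine Finset.sum_le_sum fun o _ => ?_
    have hK0 : ∀ u v, 0 ≤ K₂ u v o := fun u v => by simp only [hK₂]; split_ifs <;> simp
    have hterm : ∀ i ∈ Finset.univ, 0 ≤ p₂ (cu i) o *
          ((if ∀ j, ¬ E₂ (cu i) (cv (cu i) j) o then 1 else 0) +
            ∑ j, K₂ (cu i) (cv (cu i) j) o) := fun i _ =>
      mul_nonneg (hp₂0 _ _) (add_nonneg (by split_ifs <;> simp)
        (Finset.sum_nonneg fun j _ => hK0 _ _))
    have h30 : 0 ≤ p o * if ∀ i, ¬ E₁ (cu i) o then (1 : ℝ) else 0 :=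
      mul_nonneg (hp0 o) (by split_ifs <;> simp)
    split_ifs with hF hall hall
    · simpa using Finset.sum_nonneg hterm
    · obtain ⟨i, hi, hF⟩ := hF.resolve_left hall
      have h4 := Finset.single_le_sum hterm (Finset.mem_univ i)
      rw [mul_zero, zero_add]
      refine le_trans ?_ h4
      simp only [hp₂, hi, if_true, mul_one]
      refine le_mul_of_one_le_right (hp0 o) ?_
      rcases hF with hF | ⟨j, hj, hB⟩
      · rw [if_pos hF]
        linarith [Finset.sum_nonneg fun j (_ : j ∈ Finset.univ) => hK0 (cu i) (cv (cu i) j)]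
      · have h5 := Finset.single_le_sum (f := fun j => K₂ (cu i) (cv (cu i) j) o)
          (fun j _ => hK0 _ _) (Finset.mem_univ j)
        have h6 : K₂ (cu i) (cv (cu i) j) o = 1 := if_pos ⟨hj, hB⟩
        have : (0 : ℝ) ≤ if ∀ j, ¬ E₂ (cu i) (cv (cu i) j) o then 1 else 0 := by
          split_ifs <;> simp
        linarith
    · exact add_nonneg (by simpa using hp0 o) (Finset.sum_nonneg hterm)
    · exact add_nonneg (by simp) (Finset.sum_nonneg hterm)
  refine hfail.trans (hcu.trans ?_)
  -- the averages
  have hA := sum_mul_one_sub_pow_le hwU hwU1 hq₁0 hH₁ hE₁H M₁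
  have hsum1 : ∑ o, ∑ u, q₁ u o = 1 := hq1
  rw [hsum1, one_mul] at hA
  refine add_le_add hA ?_
  have hB2 : ∀ u, ∑ o, q₁ u o * (1 - ∑ v, if E₂ u v o then wV u v else 0) ^ M₂ ≤ _ := fun u =>
    sum_mul_one_sub_pow_le (hwV u) (hwV1 u) (hq u) hH₂ (hE₂H u) M₂
  -- Change of measure: on `E₁` the product weight `wU u * p o` is at most `q₁ u o / Lo₁`, so the
  -- cost of an independent word is controlled by the joint law. Summing over `M₁` words gives the
  -- factor `M₁ / Lo₁`.
  have hcost : ∀ u, Lo₁ * (wU u * ∑ o, p o * k u o) ≤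
      (∑ o, ∑ v, if E₂ u v o then 0 else q u v o) + (∑ o, q₁ u o) * Real.exp (-(M₂ / Hi₂)) +
        M₂ / Lo₂ * ∑ o, ∑ v, if G u v o then 0 else q u v o := fun u => by
    have hlow : ∀ o, Lo₁ * (wU u * p₂ u o) ≤ q₁ u o := fun o => by
      simp only [hp₂]
      split_ifs with h
      · simpa using hE₁L u o h
      · simpa using hq₁0 u o
    have hx : ∀ o, 0 ≤ 1 - ∑ v, if E₂ u v o then wV u v else 0 := fun o => by
      rw [← hwV1 u, ← Finset.sum_sub_distrib]
      exact Finset.sum_nonneg fun v _ => by split_ifs <;> simp [hwV]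
    rw [hk2, mul_add, mul_add]
    refine add_le_add (le_trans ?_ (hB2 u)) ?_
    · rw [Finset.mul_sum, Finset.mul_sum]
      refine Finset.sum_le_sum fun o _ => ?_
      rw [← mul_assoc, ← mul_assoc, mul_assoc Lo₁]
      exact mul_le_mul_of_nonneg_right (hlow o) (pow_nonneg (hx o) _)
    -- The same change of measure, now in both layers, for words that pass `E₂` but violate `G`.
    · have h7 : ∀ o v, Lo₂ * (wV u v * (Lo₁ * (wU u * p₂ u o)) * K₂ u v o) ≤
          if G u v o then 0 else q u v o := fun o v => by
        simp only [hK₂]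
        by_cases h : E₂ u v o ∧ ¬ G u v o
        · rw [if_pos h, if_neg h.2, mul_one]
          refine le_trans ?_ (hE₂L u v o h.1)
          gcongr
          · exact hwV u v
          · exact hlow o
        · rw [if_neg h]
          simp only [mul_zero]
          split_ifs
          · exact le_rfl
          · exact hq u v o
      rw [div_mul_eq_mul_div, le_div_iff₀ hL₂]
      calc Lo₁ * (wU u * (M₂ * ∑ v, wV u v * ∑ o, p₂ u o * K₂ u v o)) * Lo₂
          = M₂ * ∑ o, ∑ v, Lo₂ * (wV u v * (Lo₁ * (wU u * p₂ u o)) * K₂ u v o) := by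
            simp only [Finset.mul_sum, Finset.sum_mul]
            rw [Finset.sum_comm]
            exact Finset.sum_congr rfl fun o _ => Finset.sum_congr rfl fun v _ => by ring
        _ ≤ _ := mul_le_mul_of_nonneg_left (Finset.sum_le_sum fun o _ =>
            Finset.sum_le_sum fun v _ => h7 o v) (Nat.cast_nonneg _)
  have htot := Finset.sum_le_sum fun u (_ : u ∈ Finset.univ) => hcost u
  rw [← Finset.mul_sum, Finset.sum_add_distrib, Finset.sum_add_distrib, ← Finset.sum_mul,
    ← Finset.mul_sum, Finset.sum_comm (f := fun u o => ∑ v, if E₂ u v o then 0 else q u v o),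
    Finset.sum_comm (f := fun u o => q₁ u o), hsum1, one_mul,
    Finset.sum_comm (f := fun u o => ∑ v, if G u v o then 0 else q u v o)] at htot
  rw [div_mul_eq_mul_div, le_div_iff₀ hL₁]
  have := mul_le_mul_of_nonneg_left htot (Nat.cast_nonneg (α := ℝ) M₁)
  linarith

end Covering

/-! ### The probability of a joint type, given part of the sequence -/

section Types

variable {B O : Type*} [Fintype B] [Fintype O]

/-- The divergence of `T` from the product of `p` with the first marginal of `T`. -/
def condDiv (p : O → ℝ) (T : B × O → ℝ) : ℝ :=
  ∑ a, T a * Real.log (T a / (p a.2 * marg T Prod.fst a.1))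

lemma marg_fst_apply (T : B × O → ℝ) (b : B) : marg T Prod.fst b = ∑ o, T (b, o) := by
  classical
  simp only [marg, Fintype.sum_prod_type]
  rw [Finset.sum_comm]
  simp

open scoped Classical in
-- Method of types: when no letter has `p`-weight zero, on the type class of `T` the product of `p`
-- equals the product of the conditional weights `T(o | b)` times the constant `exp (-n * condDiv p
-- T)`. The total of the conditional products is at most one.
lemma sum_freq_eq_le {n : ℕ} (hn : n ≠ 0) {p : O → ℝ} (hp : ∀ o, 0 ≤ p o) (b : Fin n → B)
    (T : B × O → ℝ) :
    (∑ o : Fin n → O, if freq (fun t => (b t, o t)) = T then ∏ t, p (o t) else 0) ≤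
      Real.exp (-(n * condDiv p T)) := by
  by_cases hT : ∃ o : Fin n → O, freq (fun t => (b t, o t)) = T
  swap
  · rw [Finset.sum_eq_zero fun o _ => if_neg fun h => hT ⟨o, h⟩]
    positivity
  have hT0 : ∀ a, 0 ≤ T a := by
    obtain ⟨o, rfl⟩ := hT
    exact freq_nonneg _
  have key : ∀ o : Fin n → O, (if freq (fun t => (b t, o t)) = T then ∏ t, p (o t) else 0) ≤
      (∏ t, T (b t, o t) / marg T Prod.fst (b t)) * Real.exp (-(n * condDiv p T)) := fun o => by
    have hnn : 0 ≤ ∏ t, T (b t, o t) / marg T Prod.fst (b t) :=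
      Finset.prod_nonneg fun t _ => div_nonneg (hT0 _) (marg_nonneg hT0 _ _)
    split_ifs with h
    swap
    · positivity
    by_cases h0 : ∃ t, p (o t) = 0
    · obtain ⟨t, ht⟩ := h0
      rw [Finset.prod_eq_zero (Finset.mem_univ t) ht]
      positivity
    push Not at h0
    have hTt : ∀ t, 0 < T (b t, o t) := fun t => by
      rw [← h]; exact freq_pos (fun t => (b t, o t)) t
    have hMt : ∀ t, 0 < marg T Prod.fst (b t) := fun t =>
      (hTt t).trans_le (le_marg hT0 Prod.fst (b t, o t))
    have hpt : ∀ t, 0 < p (o t) := fun t => lt_of_le_of_ne (hp _) (h0 t).symm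
    have hsum := sum_freq_mul hn (fun t => (b t, o t)) fun a =>
      Real.log (T a / (p a.2 * marg T Prod.fst a.1))
    rw [h] at hsum
    rw [condDiv, hsum, ← Finset.sum_neg_distrib, Real.exp_sum, ← Finset.prod_mul_distrib]
    refine le_of_eq (Finset.prod_congr rfl fun t _ => ?_)
    have := hTt t; have := hMt t; have := hpt t
    rw [← Real.log_inv, Real.exp_log (by positivity)]
    field_simp
  refine (Finset.sum_le_sum fun o _ => key o).trans ?_
  rw [← Finset.sum_mul]
  refine mul_le_of_le_one_left (Real.exp_nonneg _) ?_
  rw [sum_prod_fun fun t o => T (b t, o) / marg T Prod.fst (b t)]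
  refine Finset.prod_le_one (fun t _ => Finset.sum_nonneg fun o _ =>
    div_nonneg (hT0 _) (marg_nonneg hT0 _ _)) fun t _ => ?_
  rw [← Finset.sum_div, ← marg_fst_apply]
  exact div_self_le_one _

/-- Types are indexed by integer counts between `0` and `n`, so there are at most `(n + 1) ^ card S`
of them. -/
lemma exists_freq_eq {S : Type*} {n : ℕ} (ω : Fin n → S) :
    ∃ k : S → Fin (n + 1), freq ω = fun s => (k s : ℝ) / n := by
  classical
  refine ⟨fun s => ⟨(Finset.univ.filter fun t => ω t = s).card, Nat.lt_succ_of_le ?_⟩, ?_⟩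
  · exact (Finset.card_le_univ _).trans (by simp)
  · funext s
    rw [freq, marg, ← Finset.sum_filter]
    simp [div_eq_mul_inv]

open scoped Classical in
/-- Bound on the probability that a sequence has a joint type in a given set. -/
lemma sum_freq_mem_le {n : ℕ} (hn : n ≠ 0) {p : O → ℝ} (hp : ∀ o, 0 ≤ p o) (b : Fin n → B)
    (C : (Fin n → O) → Prop) {κ : ℝ}
    (hC : ∀ o, C o → (∀ t, p (o t) ≠ 0) → κ ≤ condDiv p (freq fun t => (b t, o t))) :
    (∑ o : Fin n → O, if C o then ∏ t, p (o t) else 0) ≤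
      (n + 1) ^ Fintype.card (B × O) * Real.exp (-(n * κ)) := by
  set τ : (B × O → Fin (n + 1)) → B × O → ℝ := fun k a => (k a : ℝ) / n with hτ
  have hprod : ∀ o : Fin n → O, 0 ≤ ∏ t, p (o t) := fun o => Finset.prod_nonneg fun t _ => hp _
  have h1 : ∀ k, (∑ o : Fin n → O, if C o ∧ freq (fun t => (b t, o t)) = τ k
      then ∏ t, p (o t) else 0) ≤ Real.exp (-(n * κ)) := fun k => by
    by_cases h : ∃ o, C o ∧ (∀ t, p (o t) ≠ 0) ∧ freq (fun t => (b t, o t)) = τ k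
    · obtain ⟨o, ho, hpo, hk⟩ := h
      have hκ := hC o ho hpo
      rw [hk] at hκ
      refine le_trans (Finset.sum_le_sum fun o _ => ?_) ((sum_freq_eq_le hn hp b (τ k)).trans ?_)
      · have := hprod o
        by_cases h : freq (fun t => (b t, o t)) = τ k
        · simp only [h, and_true, if_true]; split_ifs <;> simp [this]
        · simp [h]
      · gcongr
    · refine le_trans (le_of_eq (Finset.sum_eq_zero fun o _ => ?_)) (Real.exp_nonneg _)
      split_ifs with ho
      · by_contra hne
        exact h ⟨o, ho.1, fun t ht => hne (Finset.prod_eq_zero (Finset.mem_univ t) ht), ho.2⟩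
      · rfl
  calc (∑ o : Fin n → O, if C o then ∏ t, p (o t) else 0)
      ≤ ∑ o : Fin n → O, ∑ k, if C o ∧ freq (fun t => (b t, o t)) = τ k
          then ∏ t, p (o t) else 0 := by
        refine Finset.sum_le_sum fun o _ => ?_
        have hnn : ∀ k ∈ Finset.univ, 0 ≤ if C o ∧ freq (fun t => (b t, o t)) = τ k
            then ∏ t, p (o t) else 0 := fun k _ => by split_ifs <;> simp [hprod o]
        split_ifs with ho
        · obtain ⟨k, hk⟩ := exists_freq_eq fun t => (b t, o t)
          refine le_trans ?_ (Finset.single_le_sum hnn (Finset.mem_univ k))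
          rw [if_pos ⟨ho, hk⟩]
        · exact Finset.sum_nonneg hnn
    _ ≤ ∑ k : B × O → Fin (n + 1), Real.exp (-(n * κ)) := by
        rw [Finset.sum_comm]
        exact Finset.sum_le_sum fun k _ => h1 k
    _ = _ := by simp

/-! ### Compactness -/

/-- On the compact set where `G ≤ κ - ε` the defect `d` never vanishes, so it has a positive
minimum; half of this minimum serves as `δ`. -/
lemma exists_pos_of_compact {E : Type*} [TopologicalSpace E] {K : Set E} (hK : IsCompact K)
    {G d : E → ℝ} (hG : ContinuousOn G K) (hd : ContinuousOn d K) (hd0 : ∀ T ∈ K, 0 ≤ d T) {κ : ℝ}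
    (h : ∀ T ∈ K, d T = 0 → κ ≤ G T) {ε : ℝ} (hε : 0 < ε) :
    ∃ δ, 0 < δ ∧ ∀ T ∈ K, d T ≤ δ → κ - ε ≤ G T := by
  have hcl : IsCompact (K ∩ G ⁻¹' Set.Iic (κ - ε)) := by
    obtain ⟨C, hC, hC'⟩ := continuousOn_iff_isClosed.1 hG (Set.Iic (κ - ε)) isClosed_Iic
    rw [Set.inter_comm, hC', Set.inter_comm]
    exact hK.inter_right hC
  rcases (K ∩ G ⁻¹' Set.Iic (κ - ε)).eq_empty_or_nonempty with he | hne
  · refine ⟨1, one_pos, fun T hT _ => ?_⟩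
    by_contra! hlt
    exact (he ▸ (⟨hT, hlt.le⟩ : T ∈ K ∩ G ⁻¹' Set.Iic (κ - ε)) : T ∈ (∅ : Set E))
  · obtain ⟨T₀, ⟨hT₀, hG₀⟩, hmin⟩ := hcl.exists_isMinOn hne (hd.mono Set.inter_subset_left)
    have hpos : 0 < d T₀ := by
      refine lt_of_le_of_ne (hd0 T₀ hT₀) fun h0 => ?_
      have h1 := h T₀ hT₀ h0.symm
      have h2 : G T₀ ≤ κ - ε := hG₀
      linarith
    refine ⟨d T₀ / 2, half_pos hpos, fun T hT hdT => ?_⟩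
    by_contra! hlt
    have := hmin (⟨hT, hlt.le⟩ : T ∈ K ∩ G ⁻¹' Set.Iic (κ - ε))
    simp only [Set.mem_ofPred_eq] at this
    linarith

lemma continuous_marg {A S : Type*} [Fintype A] (π : A → S) :
    Continuous fun T : A → ℝ => marg T π := by
  classical
  refine continuous_pi fun s => continuous_finsetSum _ fun a _ => ?_
  split_ifs
  · exact continuous_apply a
  · exact continuous_const

/-- If the divergence is at least `κ` on the distributions with prescribed marginals, then it is at
least `κ - ε` on the distributions with nearly these marginals. -/
lemma exists_pos_condDiv {S₁ S₂ S₃ : Type*} [Fintype S₁] [Fintype S₂] [Fintype S₃] {p : O → ℝ}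
    (π₁ : B × O → S₁) (π₂ : B × O → S₂) (π₃ : B × O → S₃)
    (q₁ : S₁ → ℝ) (q₂ : S₂ → ℝ) (q₃ : S₃ → ℝ) {κ : ℝ}
    (h : ∀ T : B × O → ℝ, (∀ a, 0 ≤ T a) → ∑ a, T a = 1 → (∀ a, p a.2 = 0 → T a = 0) →
      marg T π₁ = q₁ → marg T π₂ = q₂ → marg T π₃ = q₃ → κ ≤ condDiv p T) {ε : ℝ} (hε : 0 < ε) :
    ∃ δ, 0 < δ ∧ ∀ T : B × O → ℝ, (∀ a, 0 ≤ T a) → ∑ a, T a = 1 → (∀ a, p a.2 = 0 → T a = 0) →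
      (∀ s, |marg T π₁ s - q₁ s| ≤ δ) → (∀ s, |marg T π₂ s - q₂ s| ≤ δ) →
      (∀ s, |marg T π₃ s - q₃ s| ≤ δ) → κ - ε ≤ condDiv p T := by
  classical
  set K : Set (B × O → ℝ) := stdSimplex ℝ (B × O) ∩ {T | ∀ a, p a.2 = 0 → T a = 0} with hKdef
  have hK : IsCompact K := by
    refine (isCompact_stdSimplex ℝ (B × O)).inter_right ?_
    simp only [Set.ofPred_forall]
    exact isClosed_iInter fun a => isClosed_iInter fun _ =>
      isClosed_eq (continuous_apply a) continuous_const
  -- As a combination of entropies and a linear term the divergence is continuous, also at the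
  -- boundary of the simplex. The support condition in `K` makes the two expressions agree where `p`
  -- vanishes.
  have hGeq : ∀ T ∈ K, condDiv p T = -(∑ a, Real.negMulLog (T a)) - ∑ a, T a * Real.log (p a.2) +
      ∑ b, Real.negMulLog (marg T Prod.fst b) := by
    rintro T ⟨⟨hT0, -⟩, hT2⟩
    have hb : ∑ b, Real.negMulLog (marg T Prod.fst b) =
        -∑ a, T a * Real.log (marg T Prod.fst a.1) := by
      rw [← sum_marg_mul T Prod.fst fun b => Real.log (marg T Prod.fst b),
        ← Finset.sum_neg_distrib]
      exact Finset.sum_congr rfl fun b _ => by rw [Real.negMulLog]; ring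
    rw [hb, condDiv, ← sub_eq_add_neg, ← Finset.sum_neg_distrib, ← Finset.sum_sub_distrib,
      ← Finset.sum_sub_distrib]
    refine Finset.sum_congr rfl fun a _ => ?_
    rcases (hT0 a).eq_or_lt with h0 | hpos
    · simp [← h0]
    · have h1 : p a.2 ≠ 0 := fun h => hpos.ne' (hT2 a h)
      have h2 : marg T Prod.fst a.1 ≠ 0 := (hpos.trans_le (le_marg hT0 Prod.fst a)).ne'
      rw [Real.log_div hpos.ne' (mul_ne_zero h1 h2), Real.log_mul h1 h2, Real.negMulLog]
      ring
  have hG : ContinuousOn (condDiv p) K := by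
    refine ContinuousOn.congr (Continuous.continuousOn ?_) hGeq
    have hm : ∀ b, Continuous fun T : B × O → ℝ => marg T Prod.fst b := fun b =>
      (continuous_apply b).comp (continuous_marg Prod.fst)
    refine ((continuous_finsetSum _ fun a _ => Real.continuous_negMulLog.comp
      (continuous_apply a)).neg.sub (continuous_finsetSum _ fun a _ =>
      (continuous_apply a).mul continuous_const)).add (continuous_finsetSum _ fun b _ =>
      Real.continuous_negMulLog.comp (hm b))
  set d : (B × O → ℝ) → ℝ := fun T =>
    max (dist (marg T π₁) q₁) (max (dist (marg T π₂) q₂) (dist (marg T π₃) q₃)) with hd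
  have hdc : Continuous d := ((continuous_marg π₁).dist continuous_const).max
    (((continuous_marg π₂).dist continuous_const).max
      ((continuous_marg π₃).dist continuous_const))
  obtain ⟨δ, hδ, hδ'⟩ := exists_pos_of_compact hK hG hdc.continuousOn
    (fun T _ => dist_nonneg.trans (le_max_left _ _)) (κ := κ) (fun T hT h0 => by
      have h1 : dist (marg T π₁) q₁ ≤ 0 := h0 ▸ le_max_left _ _
      have h2 : dist (marg T π₂) q₂ ≤ 0 := h0 ▸ (le_max_left _ _).trans (le_max_right _ _)
      have h3 : dist (marg T π₃) q₃ ≤ 0 := h0 ▸ (le_max_right _ _).trans (le_max_right _ _)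
      exact h T hT.1.1 hT.1.2 hT.2 (dist_le_zero.1 h1) (dist_le_zero.1 h2) (dist_le_zero.1 h3)) hε
  refine ⟨δ, hδ, fun T hT0 hT1 hT2 h1 h2 h3 => hδ' T ⟨⟨hT0, hT1⟩, hT2⟩ (max_le ?_ (max_le ?_ ?_))⟩
  · exact (dist_pi_le_iff hδ.le).2 h1
  · exact (dist_pi_le_iff hδ.le).2 h2
  · exact (dist_pi_le_iff hδ.le).2 h3

end Types

/-! ### Asymptotics -/

section Asymptotics

lemma tendsto_exp_neg_mul_natCast {c : ℝ} (hc : 0 < c) :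
    Tendsto (fun n : ℕ => Real.exp (-c * n)) atTop (nhds 0) := by
  refine Real.tendsto_exp_atBot.comp ?_
  exact tendsto_natCast_atTop_atTop.const_mul_atTop_of_neg (neg_neg_of_pos hc)

lemma tendsto_exp_mul_exp_neg_exp (a : ℝ) {δ : ℝ} (hδ : 0 < δ) :
    Tendsto (fun n : ℕ => Real.exp (a * n) * Real.exp (-Real.exp (δ * n))) atTop (nhds 0) := by
  have h : ∀ᶠ n : ℕ in atTop, Real.exp (a * n) * Real.exp (-Real.exp (δ * n)) ≤
      Real.exp (-1 * n) := by
    -- For such `n` the quadratic term of `exp (δ n)` satisfies `(δ n)² / 2 ≥ (a + 1) n`.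
    obtain ⟨N, hN⟩ := exists_nat_ge ((a + 1) * 2 / δ ^ 2)
    filter_upwards [eventually_ge_atTop N] with n hn
    rw [← Real.exp_add]
    gcongr
    have h1 := Real.quadratic_le_exp_of_nonneg (show 0 ≤ δ * n by positivity)
    have h2 : (a + 1) * 2 / δ ^ 2 ≤ n := hN.trans (by exact_mod_cast hn)
    rw [div_le_iff₀ (by positivity)] at h2
    have h3 : (0 : ℝ) ≤ δ * n := by positivity
    nlinarith [Nat.cast_nonneg (α := ℝ) n]
  exact squeeze_zero' (Eventually.of_forall fun n => by positivity) h
    (tendsto_exp_neg_mul_natCast one_pos)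

lemma eventually_polynomial_le_exp (C : ℝ) (k : ℕ) {ε : ℝ} (hε : 0 < ε) :
    ∀ᶠ n : ℕ in atTop, C * (n + 1 : ℝ) ^ k ≤ Real.exp (ε * n) := by
  have h := (tendsto_exp_mul_div_rpow_atTop k ε hε).comp
    ((tendsto_natCast_atTop_atTop (R := ℝ)).comp (tendsto_add_atTop_nat 1))
  filter_upwards [h.eventually_ge_atTop (C * Real.exp ε)] with n hn
  simp only [Function.comp, Real.rpow_natCast] at hn
  push_cast at hn
  rw [le_div_iff₀ (by positivity), mul_add, mul_one, Real.exp_add] at hn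
  have : 0 < Real.exp ε := Real.exp_pos _
  nlinarith

/-- The shape of the two-layer covering bound: `γᵢ` is the exponential excess of `Mᵢ` over the lower
density bound, and `cᵢ` is the rate at which the `i`-th typicality test fails. The rate of a test
has to beat the excesses of all earlier layers. -/
lemma tendsto_failure_bound (K₁ K₂ K₃ : ℝ) {c₁ c₂ c₃ γ₁ γ₂ δ₁ δ₂ : ℝ} (hc₁ : 0 < c₁)
    (hc₂ : γ₁ < c₂) (hc₃ : γ₁ + γ₂ < c₃) (hδ₁ : 0 < δ₁) (hδ₂ : 0 < δ₂) :
    Tendsto (fun n : ℕ => K₁ * Real.exp (-c₁ * n) + Real.exp (-Real.exp (δ₁ * n)) +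
      2 * Real.exp (γ₁ * n) * (K₂ * Real.exp (-c₂ * n) + Real.exp (-Real.exp (δ₂ * n)) +
        2 * Real.exp (γ₂ * n) * (K₃ * Real.exp (-c₃ * n)))) atTop (nhds 0) := by
  have h1 := (tendsto_exp_neg_mul_natCast hc₁).const_mul K₁
  have h2 := tendsto_exp_mul_exp_neg_exp 0 hδ₁
  have h3 := (tendsto_exp_neg_mul_natCast (sub_pos.2 hc₂)).const_mul (2 * K₂)
  have h4 := (tendsto_exp_mul_exp_neg_exp γ₁ hδ₂).const_mul 2
  have h5 := (tendsto_exp_neg_mul_natCast (sub_pos.2 hc₃)).const_mul (4 * K₃)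
  have h := (((h1.add h2).add h3).add h4).add h5
  simp only [mul_zero, add_zero] at h
  refine h.congr fun n => ?_
  have e1 : Real.exp (-(c₂ - γ₁) * n) = Real.exp (γ₁ * n) * Real.exp (-c₂ * n) := by
    rw [← Real.exp_add]; congr 1; ring
  have e2 : Real.exp (-(c₃ - (γ₁ + γ₂)) * n) =
      Real.exp (γ₁ * n) * Real.exp (γ₂ * n) * Real.exp (-c₃ * n) := by
    rw [← Real.exp_add, ← Real.exp_add]; congr 1; ring
  rw [e1, e2, zero_mul, Real.exp_zero]
  ring

lemma ceil_exp_le {x : ℝ} (hx : 0 ≤ x) : (⌈Real.exp x⌉₊ : ℝ) ≤ 2 * Real.exp x := by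
  linarith [Nat.ceil_lt_add_one (Real.exp_nonneg x), Real.one_le_exp hx]

end Asymptotics

/-! ### The coding scheme -/

/-- A coding scheme for a test of one hypothesis: the messages carry, in addition to the codeword
indices, a failure symbol. -/
structure Scheme (X Y Z : Type*) (n : ℕ) where
  /-- number of indices of the sensor -/
  M₁ : ℕ
  /-- number of indices of the relay -/
  M₂ : ℕ
  /-- encoder -/
  enc : (Fin n → X) → Option (Fin M₁)
  /-- relay -/
  relay : Fin M₁ → (Fin n → Y) → Option (Fin M₂)
  /-- acceptance region -/
  acc : Fin M₁ → Fin M₂ → (Fin n → Z) → Prop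

/-- The scheme accepts the given observations. -/
def Scheme.Accepts {X Y Z : Type*} {n : ℕ} (s : Scheme X Y Z n) (x : Fin n → X) (y : Fin n → Y)
    (z : Fin n → Z) : Prop :=
  ∃ i j, s.enc x = some i ∧ s.relay i y = some j ∧ s.acc i j z

open scoped Classical in
/-- Some index with the property `P`, if there is one. -/
def pick {M : ℕ} (P : Fin M → Prop) : Option (Fin M) :=
  if h : ∃ i, P i then some h.choose else none

lemma pick_some {M : ℕ} {P : Fin M → Prop} {i : Fin M} (h : pick P = some i) : P i := by
  unfold pick at h
  split_ifs at h with hP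
  rw [← Option.some.inj h]
  exact hP.choose_spec

lemma pick_none {M : ℕ} {P : Fin M → Prop} (h : pick P = none) (i : Fin M) : ¬ P i := by
  unfold pick at h
  split_ifs at h with hP
  exact fun hi => hP ⟨i, hi⟩

/-- Gibbs' inequality, from `log x ≥ 1 - 1 / x`, for a weight `q` with density `f` relative to `r`.
-/
lemma sum_mul_log_nonneg {A : Type*} [Fintype A] {q r f : A → ℝ} (hq : ∀ a, 0 ≤ q a)
    (hr : ∀ a, 0 ≤ r a) (hrq : ∑ a, r a ≤ ∑ a, q a) (h : ∀ a, q a = r a * f a) :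
    0 ≤ ∑ a, q a * Real.log (f a) := by
  have key : ∀ a, q a - r a ≤ q a * Real.log (f a) := fun a => by
    rcases (hq a).eq_or_lt with h0 | hpos
    · rw [← h0]; linarith [hr a]
    · have hf : 0 < f a := by
        rcases lt_or_ge 0 (f a) with hf | hf
        · exact hf
        · exact absurd (h a ▸ hpos) (not_lt.2 (mul_nonpos_of_nonneg_of_nonpos (hr a) hf))
      have h1 := Real.one_sub_inv_le_log_of_pos hf
      have h2 : r a = q a * (f a)⁻¹ := by rw [h a]; field_simp
      have := mul_le_mul_of_nonneg_left h1 hpos.le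
      linarith
  have := Finset.sum_le_sum fun a (_ : a ∈ Finset.univ) => key a
  rw [Finset.sum_sub_distrib] at this
  linarith

/-- Equipartition: the logarithm of the product is a sum of letter values, which typicality keeps
close to `n` times its mean. With `f` a density, this yields the bounds `Lo` and `Hi` of the
covering theorem. -/
lemma IsTypical.prod_mem {S : Type*} [Fintype S] {n : ℕ} (hn : n ≠ 0) {δ : ℝ} {Q f : S → ℝ}
    (hQ : ∀ s, 0 ≤ Q s) (hf : ∀ s, 0 < Q s → 0 < f s) {ω : Fin n → S} (h : IsTypical δ Q ω) :
    Real.exp (n * (∑ s, Q s * Real.log (f s) - δ * ∑ s, Q s * |Real.log (f s)|)) ≤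
        ∏ t, f (ω t) ∧
      ∏ t, f (ω t) ≤
        Real.exp (n * (∑ s, Q s * Real.log (f s) + δ * ∑ s, Q s * |Real.log (f s)|)) := by
  have h1 : ∏ t, f (ω t) = Real.exp (∑ t, Real.log (f (ω t))) := by
    rw [Real.exp_sum]
    exact Finset.prod_congr rfl fun t _ => (Real.exp_log (hf _ (h.pos hQ t))).symm
  have h2 := abs_le.1 (h.abs_sum_sub_le hn fun s => Real.log (f s))
  rw [h1]
  constructor <;> gcongr <;> linarith [h2.1, h2.2]

section Core

variable {U V O X Y Z : Type*} [Fintype U] [Fintype V] [Fintype O]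

lemma sum_fun_triple {n : ℕ} (F : (Fin n → (U × V) × O) → ℝ) :
    ∑ ω, F ω = ∑ o : Fin n → O, ∑ u : Fin n → U, ∑ v : Fin n → V,
      F fun t => ((u t, v t), o t) := by
  rw [sum_fun_prod, Finset.sum_comm]
  exact Finset.sum_congr rfl fun o _ => sum_fun_prod fun b => F fun t => (b t, o t)

/-- The data of a two-layer test channel: `q` is the joint law of the auxiliaries and of the
observations, `f₁` and `f₂` are the densities of the two layers, which depend on the observations
through `πx` and `πy` only. -/
structure TestChannel (q : (U × V) × O → ℝ) (πx : O → X) (πy : O → Y) (wU : U → ℝ)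
    (wV : U → V → ℝ) (f₁ : U × X → ℝ) (f₂ : (U × V) × Y → ℝ) : Prop where
  nonneg : ∀ a, 0 ≤ q a
  sum_eq_one : ∑ a, q a = 1
  wU_nonneg : ∀ u, 0 ≤ wU u
  wU_sum : ∑ u, wU u = 1
  wV_nonneg : ∀ u v, 0 ≤ wV u v
  wV_sum : ∀ u, ∑ v, wV u v = 1
  density₁ : ∀ u o, ∑ v, q ((u, v), o) = wU u * (∑ u', ∑ v, q ((u', v), o)) * f₁ (u, πx o)
  density₂ : ∀ u v o, q ((u, v), o) = wV u v * (∑ v', q ((u, v'), o)) * f₂ ((u, v), πy o)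

/-- The law of `(U, X)`. -/
abbrev margUX (q : (U × V) × O → ℝ) (πx : O → X) : U × X → ℝ := marg q fun a => (a.1.1, πx a.2)

/-- The law of `((U, V), Y)`. -/
abbrev margUVY (q : (U × V) × O → ℝ) (πy : O → Y) : (U × V) × Y → ℝ :=
  marg q fun a => (a.1, πy a.2)

section

variable {q : (U × V) × O → ℝ} {πx : O → X} {πy : O → Y} {wU : U → ℝ} {wV : U → V → ℝ}
  {f₁ : U × X → ℝ} {f₂ : (U × V) × Y → ℝ}

lemma exists_pos_of_marg_pos {A S : Type*} [Fintype A] {q : A → ℝ} {π : A → S} {s : S}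
    (h : 0 < marg q π s) : ∃ a, π a = s ∧ 0 < q a := by
  classical
  obtain ⟨a, -, ha⟩ := Finset.exists_lt_of_sum_lt (s := Finset.univ) (f := fun _ : A => (0 : ℝ))
    (by simpa [marg] using h)
  by_cases hs : π a = s
  · exact ⟨a, hs, by simpa [hs] using ha⟩
  · simp [hs] at ha

lemma TestChannel.f₁_pos (h : TestChannel q πx πy wU wV f₁ f₂) (s : U × X)
    (hs : 0 < margUX q πx s) : 0 < f₁ s := by
  obtain ⟨⟨⟨u, v⟩, o⟩, rfl, ha⟩ := exists_pos_of_marg_pos hs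
  have h1 : 0 < ∑ v, q ((u, v), o) := ha.trans_le
    (Finset.single_le_sum (f := fun v => q ((u, v), o)) (fun v _ => h.nonneg _)
      (Finset.mem_univ v))
  rw [h.density₁] at h1
  refine pos_of_mul_pos_right h1 (mul_nonneg (h.wU_nonneg u) ?_)
  exact Finset.sum_nonneg fun u _ => Finset.sum_nonneg fun v _ => h.nonneg _

lemma TestChannel.f₂_pos (h : TestChannel q πx πy wU wV f₁ f₂) (s : (U × V) × Y)
    (hs : 0 < margUVY q πy s) : 0 < f₂ s := by
  obtain ⟨⟨⟨u, v⟩, o⟩, rfl, ha⟩ := exists_pos_of_marg_pos hs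
  rw [h.density₂] at ha
  refine pos_of_mul_pos_right ha (mul_nonneg (h.wV_nonneg u v) ?_)
  exact Finset.sum_nonneg fun v _ => h.nonneg _

/-- The sum is the divergence of the law of `(U, O)` from a product weight of the same mass.
Nonnegative rates ensure that rounding a codebook size up at most doubles it. -/
lemma TestChannel.rate₁_nonneg [Fintype X] (h : TestChannel q πx πy wU wV f₁ f₂) :
    0 ≤ ∑ s, margUX q πx s * Real.log (f₁ s) := by
  rw [sum_marg_mul]
  have h0 := sum_mul_log_nonneg (A := U × O) (q := fun b => ∑ v, q ((b.1, v), b.2))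
    (r := fun b => wU b.1 * ∑ u', ∑ v, q ((u', v), b.2)) (f := fun b => f₁ (b.1, πx b.2))
    (fun b => Finset.sum_nonneg fun v _ => h.nonneg _)
    (fun b => mul_nonneg (h.wU_nonneg _) (Finset.sum_nonneg fun u _ =>
      Finset.sum_nonneg fun v _ => h.nonneg _)) (le_of_eq ?_) (fun b => h.density₁ _ _)
  · refine h0.trans (le_of_eq ?_)
    simp only [Fintype.sum_prod_type, Finset.sum_mul]
    exact Finset.sum_congr rfl fun u _ => Finset.sum_comm
  · simp only [Fintype.sum_prod_type]
    simp only [← Finset.mul_sum]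
    rw [← Finset.sum_mul, h.wU_sum, one_mul, Finset.sum_comm]

lemma TestChannel.rate₂_nonneg [Fintype Y] (h : TestChannel q πx πy wU wV f₁ f₂) :
    0 ≤ ∑ s, margUVY q πy s * Real.log (f₂ s) := by
  rw [sum_marg_mul]
  refine sum_mul_log_nonneg (r := fun a => wV a.1.1 a.1.2 * ∑ v', q ((a.1.1, v'), a.2))
    h.nonneg (fun a => mul_nonneg (h.wV_nonneg _ _) (Finset.sum_nonneg fun v _ => h.nonneg _))
    (le_of_eq ?_) (fun a => h.density₂ _ _ _)
  simp only [Fintype.sum_prod_type]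
  refine Finset.sum_congr rfl fun u _ => ?_
  rw [Finset.sum_comm]
  simp only [← Finset.sum_mul, h.wV_sum, one_mul]
  exact Finset.sum_comm

open scoped Classical in
/-- The two-layer codebook for sequences of `n` letters. -/
theorem TestChannel.exists_codebook [Fintype X] [Fintype Y]
    (h : TestChannel q πx πy wU wV f₁ f₂) (πz : O → Z) {n : ℕ}
    (hn : n ≠ 0) {δ₁ δ₂ δ₃ : ℝ} {I₁ I₂ C₁ C₂ : ℝ}
    (hI₁ : I₁ = ∑ s, margUX q πx s * Real.log (f₁ s))
    (hC₁ : C₁ = ∑ s, margUX q πx s * |Real.log (f₁ s)|)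
    (hI₂ : I₂ = ∑ s, margUVY q πy s * Real.log (f₂ s))
    (hC₂ : C₂ = ∑ s, margUVY q πy s * |Real.log (f₂ s)|) (M₁ M₂ : ℕ) :
    ∃ s : Scheme X Y Z n, ∃ (cu : Fin s.M₁ → Fin n → U) (cv : Fin s.M₁ → Fin s.M₂ → Fin n → V),
      s.M₁ = M₁ ∧ s.M₂ = M₂ ∧
      (∀ x i, s.enc x = some i → IsTypical δ₁ (margUX q πx) fun t => (cu i t, x t)) ∧
      (∀ i y j, s.relay i y = some j →
        IsTypical δ₂ (margUVY q πy) fun t => ((cu i t, cv i j t), y t)) ∧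
      (∀ i j z, s.acc i j z → IsTypical δ₃ (margUVY q πz) fun t => ((cu i t, cv i j t), z t)) ∧
      seqWeight (marg q Prod.snd) n (fun o => ¬ s.Accepts (fun t => πx (o t)) (fun t => πy (o t))
        fun t => πz (o t)) ≤
      seqWeight q n (fun ω => ¬ IsTypical δ₁ (margUX q πx) fun t => ((ω t).1.1, πx (ω t).2)) +
        Real.exp (-(M₁ / Real.exp (n * (I₁ + δ₁ * C₁)))) +
      M₁ / Real.exp (n * (I₁ - δ₁ * C₁)) *
        (seqWeight q n (fun ω => ¬ IsTypical δ₂ (margUVY q πy) fun t => ((ω t).1, πy (ω t).2)) +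
          Real.exp (-(M₂ / Real.exp (n * (I₂ + δ₂ * C₂)))) +
        M₂ / Real.exp (n * (I₂ - δ₂ * C₂)) *
          seqWeight q n fun ω => ¬ IsTypical δ₃ (margUVY q πz) fun t => ((ω t).1, πz (ω t).2)) := by
  have hq := h.nonneg
  have hQ₁ : ∀ s, 0 ≤ margUX q πx s := marg_nonneg hq _
  have hQ₂ : ∀ s, 0 ≤ margUVY q πy s := marg_nonneg hq _
  set E₁ : (Fin n → U) → (Fin n → O) → Prop := fun u o =>
    IsTypical δ₁ (margUX q πx) fun t => (u t, πx (o t)) with hE₁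
  set E₂ : (Fin n → U) → (Fin n → V) → (Fin n → O) → Prop := fun u v o =>
    IsTypical δ₂ (margUVY q πy) fun t => ((u t, v t), πy (o t)) with hE₂
  set G : (Fin n → U) → (Fin n → V) → (Fin n → O) → Prop := fun u v o =>
    IsTypical δ₃ (margUVY q πz) fun t => ((u t, v t), πz (o t)) with hG
  have hsv : ∀ (u : Fin n → U) (o : Fin n → O), ∑ v : Fin n → V, ∏ t, q ((u t, v t), o t) =
      ∏ t, ∑ v, q ((u t, v), o t) := fun u o => sum_prod_fun fun t v => q ((u t, v), o t)
  have hsuv : ∀ o : Fin n → O, ∑ u : Fin n → U, ∑ v : Fin n → V, ∏ t, q ((u t, v t), o t) =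
      ∏ t, ∑ u, ∑ v, q ((u, v), o t) := fun o => by
    simp only [hsv]
    exact sum_prod_fun fun t u => ∑ v, q ((u, v), o t)
  have hsnd : ∀ o, marg q Prod.snd o = ∑ u, ∑ v, q ((u, v), o) := fun o => by
    simp only [marg, Fintype.sum_prod_type]
    simp
  have hp0 : ∀ o, 0 ≤ ∑ u, ∑ v, q ((u, v), o) := fun o =>
    Finset.sum_nonneg fun u _ => Finset.sum_nonneg fun v _ => hq _
  have hq₁0 : ∀ u o, 0 ≤ ∑ v, q ((u, v), o) := fun u o => Finset.sum_nonneg fun v _ => hq _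
  -- The densities of both layers tensorize over the letters.
  have hd₁ : ∀ (u : Fin n → U) (o : Fin n → O), ∑ v : Fin n → V, ∏ t, q ((u t, v t), o t) =
      (∏ t, f₁ (u t, πx (o t))) * ((∏ t, wU (u t)) *
        ∑ u' : Fin n → U, ∑ v : Fin n → V, ∏ t, q ((u' t, v t), o t)) := fun u o => by
    rw [hsv, hsuv, ← Finset.prod_mul_distrib, ← Finset.prod_mul_distrib]
    exact Finset.prod_congr rfl fun t _ => by rw [h.density₁]; ring
  have hd₂ : ∀ (u : Fin n → U) (v : Fin n → V) (o : Fin n → O), ∏ t, q ((u t, v t), o t) =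
      (∏ t, f₂ ((u t, v t), πy (o t))) * ((∏ t, wV (u t) (v t)) *
        ∑ v' : Fin n → V, ∏ t, q ((u t, v' t), o t)) := fun u v o => by
    rw [hsv, ← Finset.prod_mul_distrib, ← Finset.prod_mul_distrib]
    exact Finset.prod_congr rfl fun t _ => by rw [h.density₂]; ring
  have hr₁ : ∀ (u : Fin n → U) (o : Fin n → O), 0 ≤ (∏ t, wU (u t)) *
      ∑ u' : Fin n → U, ∑ v : Fin n → V, ∏ t, q ((u' t, v t), o t) := fun u o => by
    rw [hsuv]
    exact mul_nonneg (Finset.prod_nonneg fun t _ => h.wU_nonneg _)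
      (Finset.prod_nonneg fun t _ => hp0 _)
  have hr₂ : ∀ (u : Fin n → U) (v : Fin n → V) (o : Fin n → O), 0 ≤ (∏ t, wV (u t) (v t)) *
      ∑ v' : Fin n → V, ∏ t, q ((u t, v' t), o t) := fun u v o => by
    rw [hsv]
    exact mul_nonneg (Finset.prod_nonneg fun t _ => h.wV_nonneg _ _)
      (Finset.prod_nonneg fun t _ => hq₁0 _ _)
  have hdens₁ : ∀ u o, E₁ u o → _ := fun u o hE =>
    IsTypical.prod_mem hn hQ₁ h.f₁_pos (ω := fun t => (u t, πx (o t))) hE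
  have hdens₂ : ∀ u v o, E₂ u v o → _ := fun u v o hE =>
    IsTypical.prod_mem hn hQ₂ h.f₂_pos (ω := fun t => ((u t, v t), πy (o t))) hE
  rw [← hI₁, ← hC₁] at hdens₁
  rw [← hI₂, ← hC₂] at hdens₂
  obtain ⟨cu, cv, hc⟩ := exists_two_layer_codebook
    (wU := fun u : Fin n → U => ∏ t, wU (u t))
    (wV := fun (u : Fin n → U) (v : Fin n → V) => ∏ t, wV (u t) (v t))
    (q := fun u v (o : Fin n → O) => ∏ t, q ((u t, v t), o t)) (E₁ := E₁) (E₂ := E₂)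
    (G := G)
    (fun u => Finset.prod_nonneg fun t _ => h.wU_nonneg _)
    (by rw [sum_prod_fun fun _ u => wU u]; simp [h.wU_sum])
    (fun u v => Finset.prod_nonneg fun t _ => h.wV_nonneg _ _)
    (fun u => by rw [sum_prod_fun fun t v => wV (u t) v]; simp [h.wV_sum])
    (fun u v o => Finset.prod_nonneg fun t _ => hq _)
    (by
      rw [← sum_fun_triple fun ω => ∏ t, q (ω t), sum_prod_fun fun _ a => q a]
      simp [h.sum_eq_one])
    (Real.exp_pos (n * (I₁ - δ₁ * C₁))) (Real.exp_pos (n * (I₁ + δ₁ * C₁)))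
    (Real.exp_pos (n * (I₂ - δ₂ * C₂))) (Real.exp_pos (n * (I₂ + δ₂ * C₂)))
    (fun u o hE => by
      rw [hd₁ u o]
      exact mul_le_mul_of_nonneg_right (hdens₁ u o hE).1 (hr₁ u o))
    (fun u o hE => by
      rw [hd₁ u o]
      exact mul_le_mul_of_nonneg_right (hdens₁ u o hE).2 (hr₁ u o))
    (fun u v o hE => by
      rw [hd₂ u v o]
      exact mul_le_mul_of_nonneg_right (hdens₂ u v o hE).1 (hr₂ u v o))
    (fun u v o hE => by
      rw [hd₂ u v o]
      exact mul_le_mul_of_nonneg_right (hdens₂ u v o hE).2 (hr₂ u v o)) M₁ M₂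
  refine ⟨⟨M₁, M₂, fun x => pick fun i => IsTypical δ₁ (margUX q πx) fun t => (cu i t, x t),
    fun i y => pick fun j => IsTypical δ₂ (margUVY q πy) fun t => ((cu i t, cv i j t), y t),
    fun i j z => IsTypical δ₃ (margUVY q πz) fun t => ((cu i t, cv i j t), z t)⟩, cu, cv, rfl, rfl,
    fun x i hx => pick_some hx, fun i y j hj => pick_some hj, fun i j z hz => hz, ?_⟩
  have e₁ : seqWeight q n (fun ω => ¬ IsTypical δ₁ (margUX q πx)
      fun t => ((ω t).1.1, πx (ω t).2)) = ∑ o, ∑ u, if E₁ u o then 0 else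
        ∑ v : Fin n → V, ∏ t, q ((u t, v t), o t) := by
    rw [seqWeight, sum_fun_triple]
    refine Finset.sum_congr rfl fun o _ => Finset.sum_congr rfl fun u _ => ?_
    simp only [hE₁]
    split_ifs with h1
    · simp
    · rfl
  have e₂ : seqWeight q n (fun ω => ¬ IsTypical δ₂ (margUVY q πy)
      fun t => ((ω t).1, πy (ω t).2)) = ∑ o, ∑ u, ∑ v, if E₂ u v o then 0 else
        ∏ t, q ((u t, v t), o t) := by
    rw [seqWeight, sum_fun_triple]
    simp only [hE₂, ite_not]
  have e₃ : seqWeight q n (fun ω => ¬ IsTypical δ₃ (margUVY q πz)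
      fun t => ((ω t).1, πz (ω t).2)) = ∑ o, ∑ u, ∑ v, if G u v o then 0 else
        ∏ t, q ((u t, v t), o t) := by
    rw [seqWeight, sum_fun_triple]
    simp only [hG, ite_not]
  rw [e₁, e₂, e₃]
  refine le_trans (Finset.sum_le_sum fun o _ => ?_) hc
  have hpn : 0 ≤ ∑ u : Fin n → U, ∑ v : Fin n → V, ∏ t, q ((u t, v t), o t) := by
    rw [hsuv]; exact Finset.prod_nonneg fun t _ => hp0 _
  have hpeq : ∏ t, marg q Prod.snd (o t) =
      ∑ u : Fin n → U, ∑ v : Fin n → V, ∏ t, q ((u t, v t), o t) := by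
    rw [hsuv]; exact Finset.prod_congr rfl fun t _ => hsnd _
  rw [hpeq]
  -- Outside this event every admissible index leads to acceptance, so the arbitrary choices made by
  -- `pick` do not matter.
  by_cases hF : (∀ i, ¬ E₁ (cu i) o) ∨ ∃ i, E₁ (cu i) o ∧ ((∀ j, ¬ E₂ (cu i) (cv i j) o) ∨
      ∃ j, E₂ (cu i) (cv i j) o ∧ ¬ G (cu i) (cv i j) o)
  · rw [if_pos hF]
    split_ifs
    · exact le_rfl
    · exact hpn
  · rw [if_neg hF, if_neg]
    rw [not_not]
    push Not at hF
    cases hx : pick fun i => E₁ (cu i) o with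
    | none => exact absurd hF.1 (by simpa using pick_none hx)
    | some i =>
      have h1 := hF.2 i (pick_some hx)
      cases hy : pick fun j => E₂ (cu i) (cv i j) o with
      | none => exact absurd h1.1 (by simpa using pick_none hy)
      | some j => exact ⟨i, j, hx, hy, h1.2 j (pick_some hy)⟩

end

end Core

/-! ### Acceptance under the other law, and the choice of the parameters -/

section Core

variable {U V O X Y Z : Type*} [Fintype U] [Fintype V] [Fintype O]

lemma marg_le_one {A S : Type*} [Fintype A] [Fintype S] {q : A → ℝ} (hq : ∀ a, 0 ≤ q a)
    (hq1 : ∑ a, q a = 1) (π : A → S) (s : S) : marg q π s ≤ 1 := by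
  rw [← hq1, ← sum_marg q π]
  exact Finset.single_le_sum (fun s _ => marg_nonneg hq π s) (Finset.mem_univ s)

lemma IsTypical.abs_marg_freq_sub_le {A S : Type*} [Fintype A] [Fintype S] {q : A → ℝ}
    (hq : ∀ a, 0 ≤ q a) (hq1 : ∑ a, q a = 1) {π : A → S} {n : ℕ} {ω : Fin n → A} {δ δ' : ℝ}
    (hδ0 : 0 ≤ δ) (hδ : δ ≤ δ') (h : IsTypical δ (marg q π) fun t => π (ω t)) (s : S) :
    |marg (freq ω) π s - marg q π s| ≤ δ' := by
  rw [← freq_comp]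
  exact (h s).trans ((mul_le_of_le_one_right hδ0 (marg_le_one hq hq1 π s)).trans hδ)

variable [Fintype X] [Fintype Y] [Fintype Z] {q : (U × V) × O → ℝ}
  {πx : O → X} {πy : O → Y} {wU : U → ℝ} {wV : U → V → ℝ}
  {f₁ : U × X → ℝ} {f₂ : (U × V) × Y → ℝ}

/-- The probability of acceptance under the law `p`, for an arbitrary codebook. -/
lemma seqWeight_accepts_le (hq : ∀ a, 0 ≤ q a) (hq1 : ∑ a, q a = 1) {p : O → ℝ}
    (hp : ∀ o, 0 ≤ p o) {πz : O → Z} {n : ℕ} (hn : n ≠ 0) {δ δ₁ δ₂ δ₃ κ : ℝ}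
    (hδ₁ : 0 ≤ δ₁) (hδ₁' : δ₁ ≤ δ) (hδ₂ : 0 ≤ δ₂) (hδ₂' : δ₂ ≤ δ) (hδ₃ : 0 ≤ δ₃) (hδ₃' : δ₃ ≤ δ)
    (hκ : ∀ T : (U × V) × O → ℝ, (∀ a, 0 ≤ T a) → ∑ a, T a = 1 → (∀ a, p a.2 = 0 → T a = 0) →
      (∀ s, |margUX T πx s - margUX q πx s| ≤ δ) → (∀ s, |margUVY T πy s - margUVY q πy s| ≤ δ) →
      (∀ s, |margUVY T πz s - margUVY q πz s| ≤ δ) → κ ≤ condDiv p T)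
    (s : Scheme X Y Z n) (cu : Fin s.M₁ → Fin n → U) (cv : Fin s.M₁ → Fin s.M₂ → Fin n → V)
    (h₁ : ∀ x i, s.enc x = some i → IsTypical δ₁ (margUX q πx) fun t => (cu i t, x t))
    (h₂ : ∀ i y j, s.relay i y = some j →
      IsTypical δ₂ (margUVY q πy) fun t => ((cu i t, cv i j t), y t))
    (h₃ : ∀ i j z, s.acc i j z → IsTypical δ₃ (margUVY q πz) fun t => ((cu i t, cv i j t), z t)) :
    seqWeight p n (fun o => s.Accepts (fun t => πx (o t)) (fun t => πy (o t))
        fun t => πz (o t)) ≤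
      s.M₁ * s.M₂ * ((n + 1) ^ Fintype.card ((U × V) × O) * Real.exp (-(n * κ))) := by
  classical
  -- For a fixed pair of indices the codewords are deterministic and only `o` is random, so the
  -- method of types applies; the encoders enter only through a union bound.
  set C : Fin s.M₁ × Fin s.M₂ → (Fin n → O) → Prop := fun ij o =>
    s.enc (fun t => πx (o t)) = some ij.1 ∧ s.relay ij.1 (fun t => πy (o t)) = some ij.2 ∧
      s.acc ij.1 ij.2 fun t => πz (o t) with hC
  have hCle : ∀ ij, seqWeight p n (C ij) ≤
      (n + 1) ^ Fintype.card ((U × V) × O) * Real.exp (-(n * κ)) := fun ij => by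
    refine sum_freq_mem_le hn hp (fun t => (cu ij.1 t, cv ij.1 ij.2 t)) (C ij) fun o ho hpo => ?_
    set ω : Fin n → (U × V) × O := fun t => ((cu ij.1 t, cv ij.1 ij.2 t), o t) with hω
    refine hκ _ (freq_nonneg _) (sum_freq hn _) (fun a ha => ?_)
      (IsTypical.abs_marg_freq_sub_le (ω := ω) hq hq1 hδ₁ hδ₁' (h₁ _ _ ho.1))
      (IsTypical.abs_marg_freq_sub_le (ω := ω) hq hq1 hδ₂ hδ₂' (h₂ _ _ _ ho.2.1))
      (IsTypical.abs_marg_freq_sub_le (ω := ω) hq hq1 hδ₃ hδ₃' (h₃ _ _ _ ho.2.2))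
    rw [freq, marg]
    refine Finset.sum_eq_zero fun t _ => if_neg ?_
    rintro rfl
    exact hpo t ha
  refine (seqWeight_mono hp n (F := fun o => ∃ ij, C ij o) ?_).trans
    ((seqWeight_exists_le hp n C).trans ((Finset.sum_le_sum fun ij _ => hCle ij).trans
      (le_of_eq ?_)))
  · rintro o ⟨i, j, h⟩
    exact ⟨(i, j), h⟩
  · simp

/-- Existence of good coding schemes for a test channel. -/
theorem TestChannel.exists_scheme (h : TestChannel q πx πy wU wV f₁ f₂) (πz : O → Z) {p : O → ℝ}
    (hp : ∀ o, 0 ≤ p o) {I₁ I₂ θ : ℝ} (hI₁ : I₁ = ∑ s, margUX q πx s * Real.log (f₁ s))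
    (hI₂ : I₂ = ∑ s, margUVY q πy s * Real.log (f₂ s))
    (hθ : ∀ T : (U × V) × O → ℝ, (∀ a, 0 ≤ T a) → ∑ a, T a = 1 → (∀ a, p a.2 = 0 → T a = 0) →
      margUX T πx = margUX q πx → margUVY T πy = margUVY q πy → margUVY T πz = margUVY q πz →
      θ + I₁ + I₂ ≤ condDiv p T) {ε : ℝ} (hε : 0 < ε) :
    ∀ᶠ n : ℕ in atTop, ∃ s : Scheme X Y Z n,
      (s.M₁ : ℝ) ≤ Real.exp (n * (I₁ + ε)) ∧ (s.M₂ : ℝ) ≤ Real.exp (n * (I₂ + ε)) ∧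
      (∀ x i, s.enc x = some i → IsTypical ε (marg q fun a => πx a.2) x) ∧
      seqWeight (marg q Prod.snd) n (fun o => ¬ s.Accepts (fun t => πx (o t)) (fun t => πy (o t))
        fun t => πz (o t)) ≤ ε ∧
      seqWeight p n (fun o => s.Accepts (fun t => πx (o t)) (fun t => πy (o t))
        fun t => πz (o t)) ≤ Real.exp (-(n * (θ - ε))) := by
  have hq := h.nonneg
  have hq1 := h.sum_eq_one
  have hI₁0 : 0 ≤ I₁ := hI₁ ▸ h.rate₁_nonneg
  have hI₂0 : 0 ≤ I₂ := hI₂ ▸ h.rate₂_nonneg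
  obtain ⟨C₁, hC₁⟩ : ∃ C₁, C₁ = ∑ s, margUX q πx s * |Real.log (f₁ s)| := ⟨_, rfl⟩
  obtain ⟨C₂, hC₂⟩ : ∃ C₂, C₂ = ∑ s, margUVY q πy s * |Real.log (f₂ s)| := ⟨_, rfl⟩
  have hC₁0 : 0 ≤ C₁ := hC₁ ▸ Finset.sum_nonneg fun s _ =>
    mul_nonneg (marg_nonneg hq _ s) (abs_nonneg _)
  have hC₂0 : 0 ≤ C₂ := hC₂ ▸ Finset.sum_nonneg fun s _ =>
    mul_nonneg (marg_nonneg hq _ s) (abs_nonneg _)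
  -- the typicality parameters
  obtain ⟨δ, hδ, hκ⟩ := exists_pos_condDiv _ _ _ _ _ _ hθ (show 0 < ε / 4 by positivity)
  have choose_δ : ∀ (C b e : ℝ), 0 ≤ C → 0 < b → 0 < e →
      ∃ d, 0 < d ∧ d ≤ b ∧ (2 * C + 1) * d ≤ e := fun C b e hC hb he =>
    ⟨min b (e / (2 * C + 1)), lt_min hb (by positivity), min_le_left _ _, by
      refine (mul_le_mul_of_nonneg_left (min_le_right _ _) (by positivity)).trans (le_of_eq ?_)
      field_simp⟩
  -- The parameters are fixed backwards, from the final test to the sensor. Each `δᵢ` is chosen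
  -- after the failure rates of all later tests, so that `γ₁ ≤ c₂ / 3` and `γ₁ + γ₂ ≤ 2 c₃ / 3`,
  -- where `γᵢ = (2 * Cᵢ + 1) * δᵢ`.
  obtain ⟨c₃, hc₃, hc₃'⟩ := seqWeight_not_typical hq hq1
    (fun a : (U × V) × O => (a.1, πz a.2)) hδ
  obtain ⟨δ₂, hδ₂, hδ₂', hγ₂⟩ := choose_δ C₂ δ (min (ε / 8) (c₃ / 3)) hC₂0 hδ (by positivity)
  obtain ⟨c₂, hc₂, hc₂'⟩ := seqWeight_not_typical hq hq1
    (fun a : (U × V) × O => (a.1, πy a.2)) hδ₂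
  obtain ⟨δ₁, hδ₁, hδ₁', hγ₁⟩ := choose_δ C₁ (min δ ε) (min (ε / 8) (min (c₂ / 3) (c₃ / 3))) hC₁0
    (by positivity) (by positivity)
  obtain ⟨c₁, hc₁, hc₁'⟩ := seqWeight_not_typical hq hq1
    (fun a : (U × V) × O => (a.1.1, πx a.2)) hδ₁
  have hγ₂ε := hγ₂.trans (min_le_left _ _)
  have hγ₂c := hγ₂.trans (min_le_right _ _)
  have hγ₁ε := hγ₁.trans (min_le_left _ _)
  have hγ₁c₂ := hγ₁.trans ((min_le_right _ _).trans (min_le_left _ _))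
  have hγ₁c₃ := hγ₁.trans ((min_le_right _ _).trans (min_le_right _ _))
  have hr₁ : (C₁ + 1) * δ₁ ≤ ε / 8 := by nlinarith
  have hr₂ : (C₂ + 1) * δ₂ ≤ ε / 8 := by nlinarith
  have hfail := tendsto_failure_bound (2 * Fintype.card (U × X)) (2 * Fintype.card ((U × V) × Y))
    (2 * Fintype.card ((U × V) × Z)) (γ₁ := (2 * C₁ + 1) * δ₁) (γ₂ := (2 * C₂ + 1) * δ₂)
    hc₁ (c₂ := c₂) (by linarith) (c₃ := c₃) (by linarith) hδ₁ hδ₂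
  filter_upwards [hfail.eventually_le_const hε, eventually_ne_atTop 0,
    eventually_polynomial_le_exp 4 (Fintype.card ((U × V) × O)) (show 0 < ε / 4 by positivity)]
    with n hn1 hn hn2
  have hn0 : (0 : ℝ) ≤ n := Nat.cast_nonneg n
  -- The size exceeds the upper density bound `exp (n (I₁ + C₁ δ₁))` by `exp (n δ₁)`, which makes a
  -- covering failure doubly exponentially small, and the lower density bound by at most `2 exp (n
  -- (2 C₁ + 1) δ₁)`.
  set M₁ := ⌈Real.exp (n * (I₁ + (C₁ + 1) * δ₁))⌉₊ with hM₁
  set M₂ := ⌈Real.exp (n * (I₂ + (C₂ + 1) * δ₂))⌉₊ with hM₂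
  have hM₁le : (M₁ : ℝ) ≤ 2 * Real.exp (n * (I₁ + (C₁ + 1) * δ₁)) := ceil_exp_le (by positivity)
  have hM₂le : (M₂ : ℝ) ≤ 2 * Real.exp (n * (I₂ + (C₂ + 1) * δ₂)) := ceil_exp_le (by positivity)
  have hM₁ge : Real.exp (n * (I₁ + (C₁ + 1) * δ₁)) ≤ M₁ := Nat.le_ceil _
  have hM₂ge : Real.exp (n * (I₂ + (C₂ + 1) * δ₂)) ≤ M₂ := Nat.le_ceil _
  have htwo : 2 ≤ Real.exp (ε / 4 * n) := by
    have : (1 : ℝ) ≤ (n + 1 : ℝ) ^ Fintype.card ((U × V) × O) := one_le_pow₀ (by linarith)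
    linarith
  have hrate : ∀ I r : ℝ, r ≤ ε / 8 → 2 * Real.exp (n * (I + r)) ≤ Real.exp (n * (I + ε)) :=
    fun I r hr => by
      refine (mul_le_mul_of_nonneg_right htwo (Real.exp_nonneg _)).trans ?_
      rw [← Real.exp_add]
      gcongr
      nlinarith
  obtain ⟨s, cu, cv, hs₁, hs₂, h₁, h₂, h₃, hα⟩ :=
    h.exists_codebook πz hn (δ₁ := δ₁) (δ₂ := δ₂) (δ₃ := δ) hI₁ hC₁ hI₂ hC₂ M₁ M₂
  refine ⟨s, ?_, ?_, fun x i hx => ?_, ?_, ?_⟩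
  · rw [hs₁]; exact hM₁le.trans (hrate _ _ hr₁)
  · rw [hs₂]; exact hM₂le.trans (hrate _ _ hr₂)
  · have h4 := ((h₁ x i hx).map Prod.snd).mono (marg_nonneg (marg_nonneg hq _) _)
      (hδ₁'.trans (min_le_right _ _))
    have h5 : marg (margUX q πx) Prod.snd = marg q fun a => πx a.2 :=
      funext fun s => marg_marg _ _ _ _
    rwa [h5] at h4
  · refine hα.trans (le_trans ?_ hn1)
    have hdiv : ∀ (M : ℕ) (a b c : ℝ), (M : ℝ) ≤ 2 * Real.exp (n * a) → n * a - n * b = c * n →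
        M / Real.exp (n * b) ≤ 2 * Real.exp (c * n) := fun M a b c hM hc => by
      rw [← hc, Real.exp_sub, ← mul_div_assoc]
      gcongr
    have hdiv' : ∀ (M : ℕ) (a b c : ℝ), Real.exp (n * a) ≤ M → n * a - n * b = c * n →
        Real.exp (-(M / Real.exp (n * b))) ≤ Real.exp (-Real.exp (c * n)) := fun M a b c hM hc => by
      rw [← hc, Real.exp_sub]
      gcongr
    have hnn : ∀ E : (Fin n → (U × V) × O) → Prop, 0 ≤ seqWeight q n E := seqWeight_nonneg hq n
    refine add_le_add (add_le_add (hc₁' n hn) (hdiv' _ _ _ _ hM₁ge (by ring))) (mul_le_mul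
      (hdiv _ _ _ _ hM₁le (by ring)) (add_le_add (add_le_add (hc₂' n hn)
        (hdiv' _ _ _ _ hM₂ge (by ring))) (mul_le_mul (hdiv _ _ _ _ hM₂le (by ring)) (hc₃' n hn)
          (hnn _) (by positivity))) ?_ (by positivity))
    exact add_nonneg (add_nonneg (hnn _) (Real.exp_nonneg _)) (mul_nonneg (by positivity) (hnn _))
  · have hβ := seqWeight_accepts_le hq hq1 hp hn hδ₁.le (hδ₁'.trans (min_le_left _ _)) hδ₂.le hδ₂'
      hδ.le le_rfl hκ s cu cv h₁ h₂ h₃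
    refine hβ.trans ?_
    rw [hs₁, hs₂]
    clear hβ
    generalize Fintype.card ((U × V) × O) = k at hn2 ⊢
    -- The number of codeword pairs cancels `I₁ + I₂`. The loss is `ε / 8` for each rate, `ε / 4`
    -- for the number of types with the constant `4`, and `ε / 4` for compactness.
    calc (M₁ : ℝ) * M₂ * ((n + 1) ^ k *
          Real.exp (-(n * (θ + I₁ + I₂ - ε / 4))))
        ≤ (2 * Real.exp (n * (I₁ + (C₁ + 1) * δ₁))) * (2 * Real.exp (n * (I₂ + (C₂ + 1) * δ₂))) *
          ((n + 1) ^ k *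
            Real.exp (-(n * (θ + I₁ + I₂ - ε / 4)))) := by gcongr
      _ = 4 * (n + 1 : ℝ) ^ k *
          Real.exp (n * (I₁ + (C₁ + 1) * δ₁) + n * (I₂ + (C₂ + 1) * δ₂) +
            -(n * (θ + I₁ + I₂ - ε / 4))) := by
          rw [Real.exp_add, Real.exp_add]; ring
      _ ≤ Real.exp (ε / 4 * n) * Real.exp (n * (I₁ + (C₁ + 1) * δ₁) + n * (I₂ + (C₂ + 1) * δ₂) +
            -(n * (θ + I₁ + I₂ - ε / 4))) :=
          mul_le_mul_of_nonneg_right hn2 (Real.exp_nonneg _)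
      _ ≤ _ := by
          rw [← Real.exp_add, Real.exp_le_exp]
          have := mul_le_mul_of_nonneg_left (add_le_add hr₁ hr₂) hn0
          have := mul_nonneg hn0 hε.le
          linarith

end Core

/-! ### Real weights of probability mass functions -/

section Weights

variable {A B C D : Type*} [Fintype A]

/-- The probabilities of `Q`, as real numbers. -/
def weight {A : Type*} (Q : PMF A) (a : A) : ℝ := (Q a).toReal

lemma weight_nonneg {A : Type*} (Q : PMF A) (a : A) : 0 ≤ weight Q a := ENNReal.toReal_nonneg

lemma sum_weight (Q : PMF A) : ∑ a, weight Q a = 1 := by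
  unfold weight
  rw [← ENNReal.toReal_sum fun a _ => Q.apply_ne_top a, ← tsum_fintype (L := .unconditional A),
    Q.tsum_coe, ENNReal.toReal_one]

lemma weight_map (Q : PMF A) (f : A → B) : weight (Q.map f) = marg (weight Q) f := by
  classical
  funext b
  rw [weight, PMF.map_apply, tsum_fintype, ENNReal.toReal_sum, marg]
  · refine Finset.sum_congr rfl fun a _ => ?_
    by_cases h : f a = b
    · simp [h, weight]
    · simp [h, Ne.symm h]
  · intro a _
    split_ifs
    · exact Q.apply_ne_top a
    · simp

lemma weight_injective {A : Type*} {Q T : PMF A} (h : weight Q = weight T) : Q = T :=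
  PMF.ext fun a => (ENNReal.toReal_eq_toReal_iff' (Q.apply_ne_top a) (T.apply_ne_top a)).1
    (congrFun h a)

lemma exists_weight_eq {T : A → ℝ} (hT : ∀ a, 0 ≤ T a) (hT1 : ∑ a, T a = 1) :
    ∃ Q : PMF A, weight Q = T := by
  refine ⟨PMF.ofFintype (fun a => ENNReal.ofReal (T a)) ?_, ?_⟩
  · rw [← ENNReal.ofReal_sum_of_nonneg fun a _ => hT a, hT1, ENNReal.ofReal_one]
  · funext a
    simp [weight, ENNReal.toReal_ofReal (hT a)]

lemma IsMarkovChain.marg_mul {Q : PMF A} {f : A → B} {g : A → C} {h : A → D}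
    (H : IsMarkovChain (Q.map fun t => (f t, g t, h t))) (b : B) (c : C) (d : D) :
    marg (weight Q) (fun t => (f t, g t, h t)) (b, c, d) * marg (weight Q) g c =
      marg (weight Q) (fun t => (f t, g t)) (b, c) *
        marg (weight Q) (fun t => (g t, h t)) (c, d) := by
  have := congrArg ENNReal.toReal (H b c d)
  simp only [PMF.map_comp, ENNReal.toReal_mul] at this
  simp only [← weight_map]
  exact this

lemma SameConditional.marg_mul {Q T : PMF A} {f : A → B} {g : A → C}
    (H : SameConditional (Q.map fun t => (f t, g t)) (T.map fun t => (f t, g t))) (b : B) (c : C) :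
    marg (weight Q) (fun t => (f t, g t)) (b, c) * marg (weight T) g c =
      marg (weight T) (fun t => (f t, g t)) (b, c) * marg (weight Q) g c := by
  have := congrArg ENNReal.toReal (H b c)
  simp only [PMF.map_comp, ENNReal.toReal_mul] at this
  simp only [← weight_map]
  exact this

open scoped MeasureTheory in
-- Under absolute continuity the Radon-Nikodym derivative is the pointwise quotient, and the
-- integral of its logarithm is a finite sum.
lemma relEntropy_eq {T Q : PMF A} (h : ∀ a, weight Q a = 0 → weight T a = 0) :
    relEntropy T Q = ENNReal.ofReal (∑ a, weight T a * Real.log (weight T a / weight Q a)) := by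
  let _ : MeasurableSpace A := ⊤
  have h' : ∀ a, Q a = 0 → T a = 0 := fun a ha => by
    have := h a (by simp [weight, ha])
    rw [weight, ENNReal.toReal_eq_zero_iff] at this
    exact this.resolve_right (T.apply_ne_top a)
  have hden : T.toMeasure = Q.toMeasure.withDensity fun a => T a / Q a := by
    refine MeasureTheory.Measure.ext_of_singleton fun a => ?_
    rw [PMF.toMeasure_apply_singleton _ _ (MeasurableSet.singleton a),
      MeasureTheory.withDensity_apply _ (MeasurableSet.singleton a),
      MeasureTheory.lintegral_singleton,
      PMF.toMeasure_apply_singleton _ _ (MeasurableSet.singleton a)]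
    by_cases h0 : Q a = 0
    · simp [h0, h' a h0]
    · rw [ENNReal.div_mul_cancel h0 (Q.apply_ne_top a)]
  have hac : T.toMeasure ≪ Q.toMeasure := by
    rw [hden]; exact MeasureTheory.withDensity_absolutelyContinuous _ _
  have hrn : T.toMeasure.rnDeriv Q.toMeasure =ᵐ[Q.toMeasure] fun a => T a / Q a := by
    conv_lhs => rw [hden]
    exact MeasureTheory.Measure.rnDeriv_withDensity _ (measurable_of_finite _)
  have hllr : MeasureTheory.llr T.toMeasure Q.toMeasure =ᵐ[T.toMeasure]
      fun a => Real.log (weight T a / weight Q a) := by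
    filter_upwards [hac hrn] with a ha
    rw [MeasureTheory.llr, ha, ENNReal.toReal_div]; rfl
  rw [relEntropy, InformationTheory.klDiv_of_ac_of_integrable hac (MeasureTheory.Integrable.of_finite)]
  rw [MeasureTheory.integral_congr_ae hllr, PMF.integral_eq_sum]
  simp [weight]

/-- `ENNReal.ofReal` truncates at zero, so passing back to reals needs the sum to be nonnegative,
which is Gibbs' inequality. -/
lemma le_sum_of_le_relEntropy {T Q : PMF A} (h : ∀ a, weight Q a = 0 → weight T a = 0) {θ : ℝ}
    (hθ : ENNReal.ofReal θ ≤ relEntropy T Q) :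
    θ ≤ ∑ a, weight T a * Real.log (weight T a / weight Q a) := by
  rw [relEntropy_eq h] at hθ
  refine (ENNReal.ofReal_le_ofReal_iff ?_).1 hθ
  refine sum_mul_log_nonneg (weight_nonneg T) (weight_nonneg Q)
    (by rw [sum_weight, sum_weight]) fun a => ?_
  by_cases h0 : weight Q a = 0
  · rw [h0, h a h0]; simp
  · field_simp

/-- Letterwise images of independent letters are independent. This lets the first detector's scheme
work on `X × Y₁` alone. -/
lemma seqWeight_marg {S : Type*} [Fintype S] {n : ℕ} (q : A → ℝ) (π : A → S)
    (E : (Fin n → S) → Prop) :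
    seqWeight (marg q π) n E = seqWeight q n fun ω => E fun t => π (ω t) := by
  classical
  unfold seqWeight
  have h1 : ∀ ω : Fin n → S, ∏ t, marg q π (ω t) =
      ∑ a : Fin n → A, if (fun t => π (a t)) = ω then ∏ t, q (a t) else 0 := fun ω => by
    simp only [marg]
    rw [← sum_prod_fun fun t a => if π a = ω t then q a else 0]
    refine Finset.sum_congr rfl fun a _ => ?_
    split_ifs with h
    · exact Finset.prod_congr rfl fun t _ => if_pos (congrFun h t)
    · obtain ⟨t, ht⟩ : ∃ t, π (a t) ≠ ω t := by
        by_contra! h'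
        exact h (funext h')
      exact Finset.prod_eq_zero (Finset.mem_univ t) (if_neg ht)
  have h2 : ∀ ω : Fin n → S, (if E ω then ∏ t, marg q π (ω t) else 0) =
      ∑ a : Fin n → A, if (fun t => π (a t)) = ω then (if E ω then ∏ t, q (a t) else 0) else 0 :=
    fun ω => by
      split_ifs with h
      · rw [h1]
      · simp
  simp only [h2]
  rw [Finset.sum_comm]
  refine Finset.sum_congr rfl fun a _ => ?_
  rw [Finset.sum_ite_eq]
  simp

lemma iidProb_eq (P : PMF A) (n : ℕ) (E : Set (Fin n → A)) :
    iidProb P n E = ENNReal.ofReal (seqWeight (weight P) n fun ω => ω ∈ E) := by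
  classical
  have hnn : ∀ ω : Fin n → A, 0 ≤ ∏ t, weight P (ω t) := fun ω =>
    Finset.prod_nonneg fun t _ => weight_nonneg P _
  rw [iidProb, seqWeight, ENNReal.ofReal_sum_of_nonneg fun ω _ => by
    split_ifs <;> simp [hnn ω]]
  refine Finset.sum_congr rfl fun ω _ => ?_
  rw [Set.indicator_apply]
  split_ifs
  · rw [ENNReal.ofReal_prod_of_nonneg fun t _ => weight_nonneg P _]
    exact Finset.prod_congr rfl fun t _ => (ENNReal.ofReal_toReal (P.apply_ne_top _)).symm
  · simp

end Weights

/-! ### Schemes for the two detectors -/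

lemma marg_eq_zero {A S : Type*} [Fintype A] {q : A → ℝ} (hq : ∀ a, 0 ≤ q a) {π : A → S} {a : A}
    (h : marg q π (π a) = 0) : q a = 0 :=
  le_antisymm (h ▸ le_marg hq π a) (hq a)

lemma marg_eq_zero_of_comp {A B S : Type*} [Fintype A] [Fintype B] {q : A → ℝ} (hq : ∀ a, 0 ≤ q a)
    {π : A → B} (ρ : B → S) {b : B} (h : marg q (fun a => ρ (π a)) (ρ b) = 0) : marg q π b = 0 := by
  rw [← marg_marg q π ρ] at h
  exact marg_eq_zero (marg_nonneg hq _) h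

lemma marg_congr {A S S' : Type*} [Fintype A] [Fintype S] {q T : A → ℝ} {π : A → S}
    (h : marg T π = marg q π) (ρ : S → S') :
    (marg T fun a => ρ (π a)) = marg q fun a => ρ (π a) := by
  funext s
  rw [← marg_marg T π ρ, ← marg_marg q π ρ, h]

/-! ### The divergence identity that absorbs the rates -/

section LogSum

variable {U V O X Y : Type*} [Fintype U] [Fintype V] [Fintype O] [Fintype X] [Fintype Y]
  {q : (U × V) × O → ℝ} {πx : O → X} {πy : O → Y} {wU : U → ℝ} {wV : U → V → ℝ}
  {f₁ : U × X → ℝ} {f₂ : (U × V) × Y → ℝ}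

/-- On the support of `T`, `qbar` is `p ⊗ q_UV` times the two densities. As `T` shares with `q` the
marginals on which the densities depend, their expected logarithms under `T` are the two rates. The
formula for `qbar` is needed only where `T` is positive. -/
lemma TestChannel.sum_log_eq (h : TestChannel q πx πy wU wV f₁ f₂) {p : O → ℝ}
    {T qbar : (U × V) × O → ℝ} (hT : ∀ a, 0 ≤ T a) (hTp : ∀ a, p a.2 = 0 → T a = 0)
    (h₁ : margUX T πx = margUX q πx) (h₂ : margUVY T πy = margUVY q πy)
    (hqbar : ∀ a, 0 < T a → qbar a =
      p a.2 * marg q Prod.fst a.1 * (f₁ (a.1.1, πx a.2) * f₂ (a.1, πy a.2))) :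
    ∑ a, T a * Real.log (T a / qbar a) + ∑ s, margUX q πx s * Real.log (f₁ s) +
      ∑ s, margUVY q πy s * Real.log (f₂ s) = condDiv p T := by
  rw [← h₁, ← h₂, sum_marg_mul, sum_marg_mul, ← Finset.sum_add_distrib, ← Finset.sum_add_distrib,
    condDiv]
  refine Finset.sum_congr rfl fun a _ => ?_
  rcases (hT a).eq_or_lt with h0 | hpos
  · simp [← h0]
  have hfst : marg T Prod.fst = marg q Prod.fst := marg_congr h₂ Prod.fst
  have hp : p a.2 ≠ 0 := fun h0 => hpos.ne' (hTp a h0)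
  have hm : marg T Prod.fst a.1 ≠ 0 := (hpos.trans_le (le_marg hT Prod.fst a)).ne'
  have hf₁ : f₁ (a.1.1, πx a.2) ≠ 0 := (h.f₁_pos _
    (h₁ ▸ hpos.trans_le (le_marg hT (fun a : (U × V) × O => (a.1.1, πx a.2)) a))).ne'
  have hf₂ : f₂ (a.1, πy a.2) ≠ 0 := (h.f₂_pos _
    (h₂ ▸ hpos.trans_le (le_marg hT (fun a : (U × V) × O => (a.1, πy a.2)) a))).ne'
  rw [hqbar a hpos, ← hfst, Real.log_div hpos.ne' (by positivity), Real.log_mul (by positivity)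
    (by positivity), Real.log_mul hf₁ hf₂, Real.log_div hpos.ne' (by positivity)]
  ring

end LogSum

/-! ### Densities of the test channels from the Markov chains -/

section Channels

/-- The marginal of a weight on `(U × V) × O` along `((u, v), o) ↦ (u, o)`. -/
lemma marg_fst_snd_apply {U V O : Type*} [Fintype U] [Fintype V] [Fintype O]
    (q : (U × V) × O → ℝ) (u : U) (o : O) :
    marg q (fun a => (a.1.1, a.2)) (u, o) = ∑ v, q ((u, v), o) := by
  classical
  simp only [marg, Fintype.sum_prod_type, Prod.mk.injEq, ite_and]
  rw [Finset.sum_eq_single u]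
  · simp
  · intro b _ hb
    simp [hb]
  · simp

lemma marg_snd_apply {U V O : Type*} [Fintype U] [Fintype V] [Fintype O]
    (q : (U × V) × O → ℝ) (o : O) : marg q Prod.snd o = ∑ u, ∑ v, q ((u, v), o) := by
  classical
  simp only [marg, Fintype.sum_prod_type]
  simp

lemma marg_injective {A S : Type*} [Fintype A] (q : A → ℝ) {π : A → S}
    (hπ : Function.Injective π) (a : A) : marg q π (π a) = q a := by
  classical
  simp [marg, hπ.eq_iff]

/-- Given the Markov chain `U - X - O`, the density of `(U, O)` relative to the product of its
marginals is that of `(U, X)`; at letters of probability zero both sides vanish. -/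
lemma density_of_markov {U V O X : Type*} [Fintype U] [Fintype V] [Fintype O]
    {q : (U × V) × O → ℝ} (hq : ∀ a, 0 ≤ q a) {πx : O → X} {u : U} {o : O}
    (h : marg q (fun a => (a.1.1, a.2)) (u, o) * marg q (fun a => πx a.2) (πx o) =
      marg q (fun a => (a.1.1, πx a.2)) (u, πx o) * marg q Prod.snd o) :
    ∑ v, q ((u, v), o) = marg q (fun a => a.1.1) u * (∑ u', ∑ v, q ((u', v), o)) *
      (margUX q πx (u, πx o) / (marg q (fun a => a.1.1) u * marg q (fun a => πx a.2) (πx o))) := by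
  rw [← marg_fst_snd_apply, ← marg_snd_apply]
  by_cases hu : marg q (fun a => a.1.1) u = 0
  · rw [hu, marg_eq_zero_of_comp hq (b := (u, o)) Prod.fst hu]; simp
  by_cases hx : marg q (fun a => πx a.2) (πx o) = 0
  · rw [hx, marg_eq_zero_of_comp hq (b := (u, o)) (fun b => πx b.2) hx]; simp
  field_simp
  rw [h, mul_comm]

open scoped Classical in
/-- The test channel of a pair of auxiliaries. -/
lemma testChannel_pair {U V O X Y : Type*} [Fintype U] [Fintype V] [Fintype O]
    [Fintype X] [Fintype Y] {q : (U × V) × O → ℝ} (hq : ∀ a, 0 ≤ q a) (hq1 : ∑ a, q a = 1) {πx : O → X} {πy : O → Y}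
    (hU : ∀ u o, marg q (fun a => (a.1.1, a.2)) (u, o) * marg q (fun a => πx a.2) (πx o) =
      marg q (fun a => (a.1.1, πx a.2)) (u, πx o) * marg q Prod.snd o)
    (hV : ∀ u v o, q ((u, v), o) * marg q (fun a => (πy a.2, a.1.1)) (πy o, u) =
      marg q (fun a => (a.1.2, πy a.2, a.1.1)) (v, πy o, u) *
        marg q (fun a => (a.1.1, a.2)) (u, o)) :
    TestChannel q πx πy (marg q fun a => a.1.1)
      (fun u v => if marg q (fun a => a.1.1) u = 0 then marg q (fun a => a.1.2) v else
        marg q Prod.fst (u, v) / marg q (fun a => a.1.1) u)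
      (fun s => margUX q πx s / (marg q (fun a => a.1.1) s.1 * marg q (fun a => πx a.2) s.2))
      (fun s => marg q (fun a => (a.1.2, πy a.2, a.1.1)) (s.1.2, s.2, s.1.1) *
        marg q (fun a => a.1.1) s.1.1 /
          (marg q (fun a => (a.1.2, a.1.1)) (s.1.2, s.1.1) *
            marg q (fun a => (πy a.2, a.1.1)) (s.2, s.1.1))) where
  nonneg := hq
  sum_eq_one := hq1
  wU_nonneg := marg_nonneg hq _
  wU_sum := by rw [sum_marg, hq1]
  wV_nonneg u v := by
    split_ifs
    · exact marg_nonneg hq _ _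
    · exact div_nonneg (marg_nonneg hq _ _) (marg_nonneg hq _ _)
  -- At a letter `u` of probability zero the conditional law is replaced by the marginal of `V`, so
  -- that every row is a probability vector.
  wV_sum u := by
    split_ifs with h
    · rw [sum_marg, hq1]
    · rw [← Finset.sum_div, div_eq_one_iff_eq h, ← marg_fst_apply (marg q Prod.fst) u, marg_marg]
  density₁ u o := density_of_markov hq (hU u o)
  density₂ u v o := by
    rw [← marg_fst_snd_apply]
    have h1 := hV u v o
    have hvu : marg q (fun a => (a.1.2, a.1.1)) (v, u) = marg q Prod.fst (u, v) := by
      rw [← marg_injective (marg q Prod.fst) (Prod.swap_injective) (u, v), marg_marg]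
      rfl
    by_cases hu : marg q (fun a => a.1.1) u = 0
    · rw [marg_eq_zero hq (a := ((u, v), o)) (π := fun a => a.1.1) hu, hu]; simp
    by_cases hv : marg q Prod.fst (u, v) = 0
    · rw [marg_eq_zero hq (a := ((u, v), o)) (π := Prod.fst) hv]; simp [hu, hv]
    by_cases hy : marg q (fun a => (πy a.2, a.1.1)) (πy o, u) = 0
    · rw [marg_eq_zero hq (a := ((u, v), o)) (π := fun a => (πy a.2, a.1.1)) hy, hy]; simp
    simp only [hvu, if_neg hu]
    field_simp
    rw [h1]; ring

end Channels

/-! ### Informations as expected logarithms of the layer densities -/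

section Information

variable {A B C D : Type*} [Fintype A] [Fintype B] [Fintype C] [Fintype D]

lemma mutualInfo_map (Q : PMF A) (f : A → B) (g : A → C) :
    mutualInfo (Q.map fun t => (f t, g t)) = ∑ a, weight Q a *
      Real.log (marg (weight Q) (fun t => (f t, g t)) (f a, g a) /
        (marg (weight Q) f (f a) * marg (weight Q) g (g a))) := by
  rw [← sum_marg_mul (weight Q) (fun t => (f t, g t)) fun s =>
    Real.log (marg (weight Q) (fun t => (f t, g t)) s /
      (marg (weight Q) f s.1 * marg (weight Q) g s.2)), Fintype.sum_prod_type]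
  simp only [mutualInfo, PMF.map_comp, ← weight_map]
  rfl

lemma condMutualInfo_map (Q : PMF A) (f : A → B) (g : A → C) (h : A → D) :
    condMutualInfo (Q.map fun t => (f t, g t, h t)) = ∑ a, weight Q a *
      Real.log (marg (weight Q) (fun t => (f t, g t, h t)) (f a, g a, h a) *
          marg (weight Q) h (h a) /
        (marg (weight Q) (fun t => (f t, h t)) (f a, h a) *
          marg (weight Q) (fun t => (g t, h t)) (g a, h a))) := by
  rw [← sum_marg_mul (weight Q) (fun t => (f t, g t, h t)) fun s =>
    Real.log (marg (weight Q) (fun t => (f t, g t, h t)) s * marg (weight Q) h s.2.2 /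
      (marg (weight Q) (fun t => (f t, h t)) (s.1, s.2.2) *
        marg (weight Q) (fun t => (g t, h t)) (s.2.1, s.2.2)))]
  simp only [Fintype.sum_prod_type, condMutualInfo, PMF.map_comp, ← weight_map]
  rfl

end Information

lemma marg_comp_injective {A B S : Type*} [Fintype A] [Fintype B] (q : A → ℝ) (π : A → B) {ρ : B → S}
    (hρ : Function.Injective ρ) (b : B) : marg q (fun a => ρ (π a)) (ρ b) = marg q π b := by
  rw [← marg_marg, marg_injective _ hρ]

/-! ### The two-layer test of Detector 2 -/

section Pair

variable {X Y₁ Y₂ : Type*} [Fintype X] [Fintype Y₁] [Fintype Y₂]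

/-- Schemes for the second detector. -/
theorem exists_scheme_pair {U V : Type*} [Fintype U] [Fintype V] {P Pbar : PMF (X × Y₁ × Y₂)}
    {R₁ R₂ θ : ℝ} {Q Qbar : PMF (U × V × X × Y₁ × Y₂)} (hQ : IsAuxPair P R₁ R₂ Q)
    (hQbar : IsTransferPair Pbar Q Qbar)
    (hθ : ENNReal.ofReal θ ≤ ⨅ T ∈ L₂ Q, relEntropy T Qbar) {ε : ℝ} (hε : 0 < ε) :
    ∀ᶠ n : ℕ in atTop, ∃ s : Scheme X Y₁ Y₂ n,
      (s.M₁ : ℝ) ≤ Real.exp (n * (R₁ + ε)) ∧ (s.M₂ : ℝ) ≤ Real.exp (n * (R₂ + ε)) ∧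
      (∀ x i, s.enc x = some i → IsTypical ε (marg (weight P) Prod.fst) x) ∧
      seqWeight (weight P) n (fun o => ¬ s.Accepts (fun t => (o t).1) (fun t => (o t).2.1)
        fun t => (o t).2.2) ≤ ε ∧
      seqWeight (weight Pbar) n (fun o => s.Accepts (fun t => (o t).1) (fun t => (o t).2.1)
        fun t => (o t).2.2) ≤ Real.exp (-(n * (θ - ε))) := by
  let e : (U × V) × X × Y₁ × Y₂ ≃ U × V × X × Y₁ × Y₂ := Equiv.prodAssoc U V _
  obtain ⟨Q₀, hQ₀⟩ : ∃ Q₀, Q₀ = Q.map e.symm := ⟨_, rfl⟩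
  obtain ⟨Qbar₀, hQbar₀⟩ : ∃ Q₀, Q₀ = Qbar.map e.symm := ⟨_, rfl⟩
  have hq := weight_nonneg Q₀
  have hq1 := sum_weight Q₀
  have hqb := weight_nonneg Qbar₀
  set q := weight Q₀ with hqdef
  set qbar := weight Qbar₀ with hqbardef
  -- the laws of the observations
  have hP : marg q Prod.snd = weight P := by
    rw [hqdef, ← weight_map, hQ₀, PMF.map_comp, ← hQ.marginal]; rfl
  have hPbar : marg qbar Prod.snd = weight Pbar := by
    rw [hqbardef, ← weight_map, hQbar₀, PMF.map_comp, ← hQbar.marginal]; rfl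
  -- the Markov chains
  have hU : ∀ (u : U) (o : X × Y₁ × Y₂),
      marg q (fun a => (a.1.1, a.2)) (u, o) * marg q (fun a => a.2.1) o.1 =
        marg q (fun a => (a.1.1, a.2.1)) (u, o.1) * marg q Prod.snd o := fun u o => by
    have H : IsMarkovChain (Q₀.map fun a => (a.1.1, a.2.1, a.2.2)) := by
      rw [hQ₀, PMF.map_comp]; exact hQ.markov_U
    exact H.marg_mul u o.1 o.2
  have hUbar : ∀ (u : U) (o : X × Y₁ × Y₂),
      marg qbar (fun a => (a.1.1, a.2)) (u, o) * marg qbar (fun a => a.2.1) o.1 =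
        marg qbar (fun a => (a.1.1, a.2.1)) (u, o.1) * marg qbar Prod.snd o := fun u o => by
    have H : IsMarkovChain (Qbar₀.map fun a => (a.1.1, a.2.1, a.2.2)) := by
      rw [hQbar₀, PMF.map_comp]; exact hQbar.markov_U
    exact H.marg_mul u o.1 o.2
  have hV : ∀ (u : U) (v : V) (o : X × Y₁ × Y₂),
      q ((u, v), o) * marg q (fun a => (a.2.2.1, a.1.1)) (o.2.1, u) =
        marg q (fun a => (a.1.2, a.2.2.1, a.1.1)) (v, o.2.1, u) *
          marg q (fun a => (a.1.1, a.2)) (u, o) := fun u v o => by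
    have H : IsMarkovChain (Q₀.map fun a => (a.1.2, (a.2.2.1, a.1.1), (a.2.2.2, a.2.1))) := by
      rw [hQ₀, PMF.map_comp]; exact hQ.markov_V
    -- The Markov chain lists all coordinates in another order; the rearrangement is injective and
    -- preserves weights.
    have i₁ := marg_injective q (π := fun a => (a.1.2, (a.2.2.1, a.1.1), (a.2.2.2, a.2.1)))
      (fun a b hab => by simp only [Prod.mk.injEq] at hab; ext <;> tauto) ((u, v), o)
    have i₂ := marg_comp_injective q (fun a => (a.1.1, a.2))
      (ρ := fun b => ((b.2.2.1, b.1), (b.2.2.2, b.2.1)))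
      (fun a b hab => by simp only [Prod.mk.injEq] at hab; ext <;> tauto) (u, o)
    exact (congrArg (· * _) i₁.symm).trans
      ((H.marg_mul v (o.2.1, u) (o.2.2, o.1)).trans (congrArg (_ * ·) i₂))
  have hVbar : ∀ (u : U) (v : V) (o : X × Y₁ × Y₂),
      qbar ((u, v), o) * marg qbar (fun a => (a.2.2.1, a.1.1)) (o.2.1, u) =
        marg qbar (fun a => (a.1.2, a.2.2.1, a.1.1)) (v, o.2.1, u) *
          marg qbar (fun a => (a.1.1, a.2)) (u, o) := fun u v o => by
    have H : IsMarkovChain (Qbar₀.map fun a => (a.1.2, (a.2.2.1, a.1.1), (a.2.1, a.2.2.2))) := by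
      rw [hQbar₀, PMF.map_comp]; exact hQbar.markov_V
    have i₁ := marg_injective qbar (π := fun a => (a.1.2, (a.2.2.1, a.1.1), (a.2.1, a.2.2.2)))
      (fun a b hab => by simp only [Prod.mk.injEq] at hab; ext <;> tauto) ((u, v), o)
    have i₂ := marg_comp_injective qbar (fun a => (a.1.1, a.2))
      (ρ := fun b => ((b.2.2.1, b.1), (b.2.1, b.2.2.2)))
      (fun a b hab => by simp only [Prod.mk.injEq] at hab; ext <;> tauto) (u, o)
    exact (congrArg (· * _) i₁.symm).trans
      ((H.marg_mul v (o.2.1, u) (o.1, o.2.2)).trans (congrArg (_ * ·) i₂))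
  have hcU : ∀ (u : U) (x : X),
      marg qbar (fun a => (a.1.1, a.2.1)) (u, x) * marg q (fun a => a.2.1) x =
        marg q (fun a => (a.1.1, a.2.1)) (u, x) * marg qbar (fun a => a.2.1) x := fun u x => by
    have H : SameConditional (Qbar₀.map fun a => (a.1.1, a.2.1))
        (Q₀.map fun a => (a.1.1, a.2.1)) := by
      rw [hQbar₀, hQ₀, PMF.map_comp, PMF.map_comp]; exact hQbar.cond_U
    exact H.marg_mul u x
  have hcV : ∀ (u : U) (v : V) (y : Y₁),
      marg qbar (fun a => (a.1.2, a.2.2.1, a.1.1)) (v, y, u) *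
          marg q (fun a => (a.2.2.1, a.1.1)) (y, u) =
        marg q (fun a => (a.1.2, a.2.2.1, a.1.1)) (v, y, u) *
          marg qbar (fun a => (a.2.2.1, a.1.1)) (y, u) := fun u v y => by
    have H : SameConditional (Qbar₀.map fun a => (a.1.2, (a.2.2.1, a.1.1)))
        (Q₀.map fun a => (a.1.2, (a.2.2.1, a.1.1))) := by
      rw [hQbar₀, hQ₀, PMF.map_comp, PMF.map_comp]; exact hQbar.cond_V
    exact H.marg_mul v (y, u)
  have hch := testChannel_pair hq hq1 (πx := fun o : X × Y₁ × Y₂ => o.1)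
    (πy := fun o => o.2.1) hU hV
  -- the rates
  have hI₁ : mutualInfo (Q₀.map fun a => (a.1.1, a.2.1)) ≤ R₁ := by
    rw [hQ₀, PMF.map_comp]; exact hQ.rate₁
  have hI₂ : condMutualInfo (Q₀.map fun a => (a.1.2, a.2.2.1, a.1.1)) ≤ R₂ := by
    rw [hQ₀, PMF.map_comp]; exact hQ.rate₂
  rw [mutualInfo_map] at hI₁
  rw [condMutualInfo_map] at hI₂
  have hQe : Q = Q₀.map e := by rw [hQ₀, PMF.map_comp]; simp [PMF.map_id]
  have hQbare : Qbar = Qbar₀.map e := by rw [hQbar₀, PMF.map_comp]; simp [PMF.map_id]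
  have hmap : ∀ (T : PMF ((U × V) × X × Y₁ × Y₂)) a, weight (T.map e) (e a) = weight T a :=
    fun T a => by rw [weight_map, marg_injective _ e.injective]
  have hsch := hch.exists_scheme (πz := fun o => o.2.2) (p := weight Pbar) (θ := θ)
    (weight_nonneg _) rfl rfl (fun T hT hT1 hTp h₁ h₂ h₃ => ?_) hε
  · filter_upwards [hsch] with n hn
    obtain ⟨s, hs₁, hs₂, hs₃, hs₄, hs₅⟩ := hn
    rw [sum_marg_mul] at hs₁ hs₂
    refine ⟨s, hs₁.trans ?_, hs₂.trans ?_, fun x i hx => ?_, ?_, hs₅⟩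
    · gcongr
    · gcongr
    · rw [← hP, funext (marg_marg q Prod.snd Prod.fst)]; exact hs₃ x i hx
    · rw [← hP]; exact hs₄
  -- the exponent
  have hqbar : ∀ a, 0 < T a → 0 < qbar a ∧ qbar a = weight Pbar a.2 * marg q Prod.fst a.1 *
      (margUX q (fun o => o.1) (a.1.1, a.2.1) /
          (marg q (fun a => a.1.1) a.1.1 * marg q (fun a => a.2.1) a.2.1) *
        (marg q (fun a => (a.1.2, a.2.2.1, a.1.1)) (a.1.2, a.2.2.1, a.1.1) *
          marg q (fun a => a.1.1) a.1.1 /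
          (marg q (fun a => (a.1.2, a.1.1)) (a.1.2, a.1.1) *
            marg q (fun a => (a.2.2.1, a.1.1)) (a.2.2.1, a.1.1)))) := by
    -- The conditional laws of `Q` and `Qbar` agree only where the conditioning values have positive
    -- probability under both. Positivity of `T` provides this: through the shared marginals for
    -- `Q`, and through `Pbar` and the transfer conditions for `Qbar`.
    rintro ⟨⟨u, v⟩, o⟩ ha
    have hp : 0 < weight Pbar o := lt_of_le_of_ne (weight_nonneg _ _)
      fun h0 => ha.ne' (hTp _ h0.symm)
    have pUX : 0 < marg q (fun a => (a.1.1, a.2.1)) (u, o.1) :=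
      (ha.trans_le (le_marg hT (fun a => (a.1.1, a.2.1)) _)).trans_le (le_of_eq (congrFun h₁ _))
    have pUVY : 0 < margUVY q (fun o : X × Y₁ × Y₂ => o.2.1) ((u, v), o.2.1) :=
      (ha.trans_le (le_marg hT (fun a => (a.1, a.2.2.1)) _)).trans_le (le_of_eq (congrFun h₂ _))
    obtain ⟨⟨⟨u', v'⟩, o'⟩, hb, hb'⟩ := exists_pos_of_marg_pos pUVY
    simp only [Prod.mk.injEq] at hb
    obtain ⟨⟨rfl, rfl⟩, hy⟩ := hb
    have pU := hb'.trans_le (le_marg hq (fun a => a.1.1) _)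
    have pUV := hb'.trans_le (le_marg hq Prod.fst _)
    have pVU := hb'.trans_le (le_marg hq (fun a => (a.1.2, a.1.1)) _)
    have pYU := hb'.trans_le (le_marg hq (fun a => (a.2.2.1, a.1.1)) _)
    have pVYU := hb'.trans_le (le_marg hq (fun a => (a.1.2, a.2.2.1, a.1.1)) _)
    have eVU : marg q (fun a => (a.1.2, a.1.1)) (v', u') = marg q Prod.fst (u', v') :=
      marg_comp_injective q Prod.fst Prod.swap_injective (u', v')
    have pX : 0 < marg q (fun a => a.2.1) o.1 := by
      obtain ⟨b, hb, hb'⟩ := exists_pos_of_marg_pos pUX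
      rw [← (Prod.mk.inj hb).2]
      exact hb'.trans_le (le_marg hq (fun a => a.2.1) b)
    have pXb : 0 < marg qbar (fun a => a.2.1) o.1 := by
      have : marg qbar (fun a => a.2.1) o.1 = marg (marg qbar Prod.snd) Prod.fst o.1 :=
        (marg_marg _ _ _ _).symm
      rw [this, hPbar]
      exact hp.trans_le (le_marg (weight_nonneg _) Prod.fst o)
    simp only [hy] at pYU pVYU
    have E₁ := hUbar u' o
    have E₂ := hcU u' o.1
    have E₃ := hVbar u' v' o
    have E₄ := hcV u' v' o.2.1
    rw [hPbar] at E₁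
    have pUOb : 0 < marg qbar (fun a => (a.1.1, a.2)) (u', o) := by
      have : 0 < marg qbar (fun a => (a.1.1, a.2.1)) (u', o.1) :=
        pos_of_mul_pos_left (E₂ ▸ mul_pos pUX pXb) pX.le
      exact pos_of_mul_pos_left (E₁ ▸ mul_pos this hp) pXb.le
    have pYUb : 0 < marg qbar (fun a => (a.2.2.1, a.1.1)) (o.2.1, u') := by
      obtain ⟨b, hb, hbpos⟩ := exists_pos_of_marg_pos pUOb
      obtain ⟨rfl, rfl⟩ := Prod.mk.inj hb
      exact hbpos.trans_le (le_marg hqb (fun a => (a.2.2.1, a.1.1)) b)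
    -- `qbar` is rebuilt one layer at a time, first as `Pbar(o) P(u | x)` and then with the factor
    -- `P(v | y₁, u)`. Each step combines a Markov chain with an equality of conditional laws and
    -- cancels the common positive factor.
    have e₁ : marg qbar (fun a => (a.1.1, a.2)) (u', o) =
        marg q (fun a => (a.1.1, a.2.1)) (u', o.1) * weight Pbar o / marg q (fun a => a.2.1) o.1 := by
      rw [eq_div_iff pX.ne']
      refine mul_right_cancel₀ pXb.ne' ?_
      linear_combination (marg q (fun a => a.2.1) o.1) * E₁ + weight Pbar o * E₂
    have e₂ : qbar ((u', v'), o) = marg q (fun a => (a.1.2, a.2.2.1, a.1.1)) (v', o.2.1, u') *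
        marg qbar (fun a => (a.1.1, a.2)) (u', o) / marg q (fun a => (a.2.2.1, a.1.1)) (o.2.1, u') := by
      rw [eq_div_iff pYU.ne']
      refine mul_right_cancel₀ pYUb.ne' ?_
      linear_combination (marg q (fun a => (a.2.2.1, a.1.1)) (o.2.1, u')) * E₃ +
        marg qbar (fun a => (a.1.1, a.2)) (u', o) * E₄
    refine ⟨by rw [e₂]; exact div_pos (mul_pos pVYU pUOb) pYU, ?_⟩
    rw [e₂, e₁]
    simp only [eVU]
    have := pX.ne'; have := pU.ne'; have := pUV.ne'; have := pYU.ne'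
    field_simp
  have hsum := hch.sum_log_eq hT hTp h₁ h₂ fun a ha => (hqbar a ha).2
  rw [← hsum]
  refine add_le_add (add_le_add ?_ le_rfl) le_rfl
  obtain ⟨T₀, rfl⟩ := exists_weight_eq hT hT1
  have hL : T₀.map e ∈ L₂ Q := by
    refine ⟨weight_injective ?_, weight_injective ?_, weight_injective ?_⟩
    · rw [hQe, PMF.map_comp, PMF.map_comp, weight_map, weight_map]
      exact h₁
    · rw [hQe, PMF.map_comp, PMF.map_comp, weight_map, weight_map]
      exact marg_congr h₂ fun b => (b.1.1, b.1.2, b.2)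
    · rw [hQe, PMF.map_comp, PMF.map_comp, weight_map, weight_map]
      exact marg_congr h₃ fun b => (b.1.1, b.1.2, b.2)
  have hD := le_sum_of_le_relEntropy (T := T₀.map e) (Q := Qbar) (fun b hb => ?_)
    (hθ.trans (iInf₂_le _ hL))
  · refine hD.trans (le_of_eq ?_)
    rw [hQbare, ← e.sum_comp]
    simp only [hmap]
    rfl
  · obtain ⟨a, rfl⟩ := e.surjective b
    rw [hmap]
    rw [hQbare, hmap] at hb
    by_contra hne
    exact (hqbar a (lt_of_le_of_ne (weight_nonneg _ _) (Ne.symm hne))).1.ne' hb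

end Pair

/-! ### The one-layer test of Detector 1 -/

section Single

variable {X Y₁ Y₂ : Type*} [Fintype X] [Fintype Y₁] [Fintype Y₂]

/-- Schemes for the first detector, without relay. -/
theorem exists_scheme_single {U : Type*} [Fintype U] {P Pbar : PMF (X × Y₁ × Y₂)}
    {R₁ θ : ℝ} {Qbar Q : PMF (U × X × Y₁)} (hQbar : IsAuxSingle Pbar R₁ Qbar)
    (hQ : IsTransferSingle P Qbar Q)
    (hθ : ENNReal.ofReal θ ≤ ⨅ T ∈ L₁bar Qbar, relEntropy T Q) {ε : ℝ} (hε : 0 < ε) :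
    ∀ᶠ n : ℕ in atTop, ∃ s : Scheme X Unit Y₁ n,
      (s.M₁ : ℝ) ≤ Real.exp (n * (R₁ + ε)) ∧
      (∀ x i, s.enc x = some i → IsTypical ε (marg (weight Pbar) Prod.fst) x) ∧
      seqWeight (weight Pbar) n (fun o => ¬ s.Accepts (fun t => (o t).1) (fun _ => ())
        fun t => (o t).2.1) ≤ ε ∧
      seqWeight (weight P) n (fun o => s.Accepts (fun t => (o t).1) (fun _ => ())
        fun t => (o t).2.1) ≤ Real.exp (-(n * (θ - ε))) := by
  let e : (U × Unit) × X × Y₁ ≃ U × X × Y₁ := (Equiv.prodPUnit U).prodCongr (Equiv.refl _)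
  obtain ⟨Q₀, hQ₀⟩ : ∃ Q₀, Q₀ = Qbar.map e.symm := ⟨_, rfl⟩
  obtain ⟨Qt, hQt⟩ : ∃ Q₀, Q₀ = Q.map e.symm := ⟨_, rfl⟩
  have hQ₀e : Qbar = Q₀.map e := by rw [hQ₀, PMF.map_comp]; simp [PMF.map_id]
  have hQte : Q = Qt.map e := by rw [hQt, PMF.map_comp]; simp [PMF.map_id]
  have hq := weight_nonneg Q₀
  have hq1 := sum_weight Q₀
  have hqt := weight_nonneg Qt
  set q := weight Q₀ with hqdef
  set qt := weight Qt with hqtdef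
  -- the laws of the observations
  set p : X × Y₁ → ℝ := marg (weight P) fun o => (o.1, o.2.1) with hpdef
  have hPbar : marg q Prod.snd = marg (weight Pbar) fun o => (o.1, o.2.1) := by
    rw [← weight_map Pbar]
    have := hQbar.marginal
    rw [hQ₀e, PMF.map_comp] at this
    rw [hqdef, ← weight_map]
    exact congrArg weight this
  have hP : marg qt Prod.snd = p := by
    rw [hpdef, ← weight_map P]
    have := hQ.marginal
    rw [hQte, PMF.map_comp] at this
    rw [hqtdef, ← weight_map]
    exact congrArg weight this
  have hp0 : ∀ o, 0 ≤ p o := marg_nonneg (weight_nonneg P) _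
  -- the Markov chains
  have hU : ∀ (u : U) (o : X × Y₁),
      marg q (fun a => (a.1.1, a.2)) (u, o) * marg q (fun a => a.2.1) o.1 =
        marg q (fun a => (a.1.1, a.2.1)) (u, o.1) * marg q Prod.snd o := fun u o => by
    have H : IsMarkovChain (Q₀.map fun a => (a.1.1, a.2.1, a.2.2)) := hQ₀e ▸ hQbar.markov
    exact H.marg_mul u o.1 o.2
  have hUt : ∀ (u : U) (o : X × Y₁),
      marg qt (fun a => (a.1.1, a.2)) (u, o) * marg qt (fun a => a.2.1) o.1 =
        marg qt (fun a => (a.1.1, a.2.1)) (u, o.1) * marg qt Prod.snd o := fun u o => by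
    have H : IsMarkovChain (Qt.map fun a => (a.1.1, a.2.1, a.2.2)) := hQte ▸ hQ.markov
    exact H.marg_mul u o.1 o.2
  have hcU : ∀ (u : U) (x : X),
      marg qt (fun a => (a.1.1, a.2.1)) (u, x) * marg q (fun a => a.2.1) x =
        marg q (fun a => (a.1.1, a.2.1)) (u, x) * marg qt (fun a => a.2.1) x := fun u x => by
    have H : SameConditional (Qt.map fun a => (a.1.1, a.2.1))
        (Q₀.map fun a => (a.1.1, a.2.1)) := by
      rw [hQt, hQ₀, PMF.map_comp, PMF.map_comp]; exact hQ.cond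
    exact H.marg_mul u x
  -- The second layer is trivial, with one letter, density one and hence rate zero; the third
  -- typicality test is the one on `(U, Y₁)`.
  have hch : TestChannel q (fun o : X × Y₁ => o.1) (fun _ => ()) (marg q fun a => a.1.1)
      (fun _ (_ : Unit) => 1)
      (fun s => margUX q (fun o : X × Y₁ => o.1) s /
        (marg q (fun a => a.1.1) s.1 * marg q (fun a => a.2.1) s.2)) (fun _ => 1) :=
    { nonneg := hq
      sum_eq_one := hq1
      wU_nonneg := marg_nonneg hq _
      wU_sum := by rw [sum_marg, hq1]
      wV_nonneg := fun _ _ => zero_le_one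
      wV_sum := fun _ => by simp
      density₁ := fun u o => density_of_markov hq (hU u o)
      density₂ := fun u v o => by simp }
  -- the rate
  have hI₁ : mutualInfo (Q₀.map fun a => (a.1.1, a.2.1)) ≤ R₁ := by
    rw [hQ₀, PMF.map_comp]; exact hQbar.rate
  rw [mutualInfo_map] at hI₁
  have hmap : ∀ (T : PMF ((U × Unit) × X × Y₁)) a, weight (T.map e) (e a) = weight T a :=
    fun T a => by rw [weight_map, marg_injective _ e.injective]
  have hsch := hch.exists_scheme (πz := fun o => o.2) (p := p) (θ := θ) hp0 rfl rfl
    (fun T hT hT1 hTp h₁ h₂ h₃ => ?_) hε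
  · filter_upwards [hsch] with n hn
    obtain ⟨s, hs₁, -, hs₃, hs₄, hs₅⟩ := hn
    rw [sum_marg_mul] at hs₁
    refine ⟨s, hs₁.trans ?_, fun x i hx => ?_, ?_, ?_⟩
    · gcongr
    · have h1 : marg (weight Pbar) Prod.fst = marg q fun a => a.2.1 := by
        rw [← funext (marg_marg q Prod.snd Prod.fst), hPbar]
        exact (funext (marg_marg (weight Pbar) (fun o => (o.1, o.2.1)) Prod.fst)).symm
      rw [h1]; exact hs₃ x i hx
    · rw [hPbar, seqWeight_marg] at hs₄; exact hs₄
    · rw [hpdef, seqWeight_marg] at hs₅; exact hs₅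
  -- the exponent
  have hqt' : ∀ a, 0 < T a → 0 < qt a ∧ qt a = p a.2 * marg q Prod.fst a.1 *
      (margUX q (fun o => o.1) (a.1.1, a.2.1) /
          (marg q (fun a => a.1.1) a.1.1 * marg q (fun a => a.2.1) a.2.1) * 1) := by
    rintro ⟨⟨u, v⟩, o⟩ ha
    have hp : 0 < p o := lt_of_le_of_ne (hp0 _) fun h0 => ha.ne' (hTp _ h0.symm)
    have pUX : 0 < marg q (fun a => (a.1.1, a.2.1)) (u, o.1) :=
      (ha.trans_le (le_marg hT (fun a => (a.1.1, a.2.1)) _)).trans_le (le_of_eq (congrFun h₁ _))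
    obtain ⟨b, hb, hbpos⟩ := exists_pos_of_marg_pos pUX
    obtain ⟨hb₁, hb₂⟩ := Prod.mk.inj hb
    have pU := hbpos.trans_le (le_marg hq (fun a => a.1.1) _)
    have pX := hbpos.trans_le (le_marg hq (fun a => a.2.1) _)
    rw [hb₁] at pU
    rw [hb₂] at pX
    have eU : marg q Prod.fst (u, v) = marg q (fun a => a.1.1) u :=
      marg_comp_injective q (fun a => a.1.1) (ρ := fun u => (u, v)) (Prod.mk_left_injective v) u
    have eq : marg qt (fun a => (a.1.1, a.2)) (u, o) = qt ((u, v), o) := by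
      rw [marg_fst_snd_apply]; simp
    have pXt : 0 < marg qt (fun a => a.2.1) o.1 := by
      have : marg qt (fun a => a.2.1) o.1 = marg (marg qt Prod.snd) Prod.fst o.1 :=
        (marg_marg _ _ _ _).symm
      rw [this, hP]
      exact hp.trans_le (le_marg hp0 Prod.fst o)
    have E₁ := hUt u o
    have E₂ := hcU u o.1
    rw [hP, eq] at E₁
    have e₁ : qt ((u, v), o) =
        marg q (fun a => (a.1.1, a.2.1)) (u, o.1) * p o / marg q (fun a => a.2.1) o.1 := by
      rw [eq_div_iff pX.ne']
      refine mul_right_cancel₀ pXt.ne' ?_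
      linear_combination (marg q (fun a => a.2.1) o.1) * E₁ + p o * E₂
    refine ⟨by rw [e₁]; exact div_pos (mul_pos pUX hp) pX, ?_⟩
    rw [e₁]
    simp only [eU]
    have := pX.ne'; have := pU.ne'
    field_simp
  have hsum := hch.sum_log_eq hT hTp h₁ h₂ fun a ha => (hqt' a ha).2
  rw [← hsum]
  refine add_le_add (add_le_add ?_ le_rfl) le_rfl
  obtain ⟨T₀, rfl⟩ := exists_weight_eq hT hT1
  have hL : T₀.map e ∈ L₁bar Qbar := by
    refine ⟨weight_injective ?_, weight_injective ?_⟩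
    · rw [hQ₀e, PMF.map_comp, PMF.map_comp, weight_map, weight_map]
      exact h₁
    · rw [hQ₀e, PMF.map_comp, PMF.map_comp, weight_map, weight_map]
      exact marg_congr h₃ fun b => (b.1.1, b.2)
  have hD := le_sum_of_le_relEntropy (T := T₀.map e) (Q := Q) (fun b hb => ?_)
    (hθ.trans (iInf₂_le _ hL))
  · refine hD.trans (le_of_eq ?_)
    rw [hQte, ← e.sum_comp]
    simp only [hmap]
    rfl
  · obtain ⟨a, rfl⟩ := e.surjective b
    rw [hmap]
    rw [hQte, hmap] at hb
    by_contra hne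
    exact (hqt' a (lt_of_le_of_ne (weight_nonneg _ _) (Ne.symm hne))).1.ne' hb

end Single

/-! ### Concurrent use of two schemes -/

section Combination

variable {X Y₁ Y₂ : Type*}

open scoped Classical in
/-- Two schemes whose sensors never succeed simultaneously are combined into one code. -/
lemma exists_code {n : ℕ} (s₁ : Scheme X Unit Y₁ n) (s₂ : Scheme X Y₁ Y₂ n)
    (hdisj : ∀ x i j, s₁.enc x = some i → s₂.enc x = some j → False) :
    ∃ c : Code X Y₁ Y₂ n (s₁.M₁ + s₂.M₁ + 1) (s₂.M₂ + 1),
      (∀ ω, c.guess₁ ω = 1 ↔ s₁.Accepts (fun t => (ω t).1) (fun _ => ()) fun t => (ω t).2.1) ∧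
      (∀ ω, c.guess₂ ω = 0 ↔
        s₂.Accepts (fun t => (ω t).1) (fun t => (ω t).2.1) fun t => (ω t).2.2) := by
  let κ₁ : Option (Fin s₁.M₁ ⊕ Fin s₂.M₁) ≃ Fin (s₁.M₁ + s₂.M₁ + 1) :=
    Fintype.equivFinOfCardEq (by simp)
  let κ₂ : Option (Fin s₂.M₂) ≃ Fin (s₂.M₂ + 1) := Fintype.equivFinOfCardEq (by simp)
  -- Priority is given to the first scheme; by disjointness the second one loses nothing.
  let msg : (Fin n → X) → Option (Fin s₁.M₁ ⊕ Fin s₂.M₁) := fun x =>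
    match s₁.enc x with
    | some i => some (Sum.inl i)
    | none => (s₂.enc x).map Sum.inr
  let rel : Option (Fin s₁.M₁ ⊕ Fin s₂.M₁) → (Fin n → Y₁) → Option (Fin s₂.M₂) := fun m y =>
    match m with
    | some (Sum.inr i) => s₂.relay i y
    | _ => none
  have hmsg₁ : ∀ x i, msg x = some (Sum.inl i) ↔ s₁.enc x = some i := fun x i => by
    simp only [msg]
    cases h : s₁.enc x <;> simp
  have hmsg₂ : ∀ x i, msg x = some (Sum.inr i) ↔ s₂.enc x = some i := fun x i => by
    simp only [msg]
    cases h : s₁.enc x with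
    | none => simp
    | some j => simpa using fun h' => hdisj x j i h h'
  refine ⟨⟨fun x => κ₁ (msg x), fun m y => κ₂ (rel (κ₁.symm m) y),
    -- The relay of the first scheme sees a constant sequence, so Detector 1 evaluates it locally
    -- and no rate is spent. Without acceptance Detector 1 declares 0 and Detector 2 declares 1.
    fun m y => if ∃ i j, κ₁.symm m = some (Sum.inl i) ∧ s₁.relay i (fun _ => ()) = some j ∧
      s₁.acc i j y then 1 else 0,
    fun m m' z => if ∃ i j, κ₁.symm m = some (Sum.inr i) ∧ κ₂.symm m' = some j ∧
      s₂.acc i j z then 0 else 1⟩, fun ω => ?_, fun ω => ?_⟩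
  · simp only [Code.guess₁, Equiv.symm_apply_apply, hmsg₁, Scheme.Accepts]
    split_ifs with h
    · exact iff_of_true rfl h
    · exact iff_of_false (by decide) h
  · have h1 : ∀ i j, (msg (fun t => (ω t).1) = some (Sum.inr i) ∧
        rel (msg fun t => (ω t).1) (fun t => (ω t).2.1) = some j ∧
          s₂.acc i j fun t => (ω t).2.2) ↔
        (s₂.enc (fun t => (ω t).1) = some i ∧ s₂.relay i (fun t => (ω t).2.1) = some j ∧
          s₂.acc i j fun t => (ω t).2.2) := fun i j => by
      rw [← hmsg₂]
      refine and_congr_right fun h => ?_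
      rw [h]
    simp only [Code.guess₂, Equiv.symm_apply_apply, Scheme.Accepts, h1]
    split_ifs with h
    · exact iff_of_true rfl h
    · exact iff_of_false (by decide) h

/-- Slowly vanishing parameters. -/
lemma exists_tendsto_zero {p : ℝ → ℕ → Prop} (h : ∀ ε, 0 < ε → ∀ᶠ n in atTop, p ε n) :
    ∃ e : ℕ → ℝ, Tendsto e atTop (nhds 0) ∧ (∀ n, 0 < e n) ∧ ∀ᶠ n in atTop, p (e n) n := by
  classical
  let k : ℕ → ℕ := fun n => Nat.findGreatest (fun k => p (1 / ((k : ℝ) + 1)) n) n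
  have hk : Tendsto k atTop atTop := by
    refine tendsto_atTop.2 fun K => ?_
    filter_upwards [h (1 / ((K : ℝ) + 1)) (by positivity), eventually_ge_atTop K] with n hn hKn
    exact Nat.le_findGreatest hKn hn
  refine ⟨fun n => 1 / ((k n : ℝ) + 1), tendsto_one_div_add_atTop_nhds_zero_nat.comp hk,
    fun n => by positivity, ?_⟩
  -- `Nat.findGreatest` also returns 0 when no index qualifies, so only nonzero values certify the
  -- property.
  filter_upwards [hk.eventually_ge_atTop 1] with n hn
  exact Nat.findGreatest_of_ne_zero (P := fun k => p (1 / ((k : ℝ) + 1)) n) rfl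
    (Nat.one_le_iff_ne_zero.1 hn)

lemma limsup_log_le {W : ℕ → ℕ} {e : ℕ → ℝ} (he : Tendsto e atTop (nhds 0)) (he0 : ∀ n, 0 < e n)
    {R : ℝ} (hR : 0 ≤ R) (h : ∀ᶠ n : ℕ in atTop, (W n : ℝ) ≤ Real.exp (n * (R + e n))) :
    limsup (fun n : ℕ => ((1 / (n : ℝ) * Real.log (W n) : ℝ) : EReal)) atTop ≤ (R : EReal) := by
  have hlim : Tendsto (fun n => ((R + e n : ℝ) : EReal)) atTop (nhds (R : EReal)) := by
    refine (continuous_coe_real_ereal.tendsto R).comp ?_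
    simpa using he.const_add R
  rw [← hlim.limsup_eq]
  refine limsup_le_limsup ?_
  filter_upwards [h, eventually_gt_atTop 0] with n hn hn0
  have hn0' : (0 : ℝ) < n := by exact_mod_cast hn0
  rw [EReal.coe_le_coe_iff, one_div, inv_mul_le_iff₀ hn0']
  rcases (Nat.zero_le (W n)).eq_or_lt with h0 | hpos
  -- Here `Real.log 0 = 0`, and the bound holds because `R + e n` is positive.
  · rw [← h0]
    have := he0 n
    simp; positivity
  · rw [Real.log_le_iff_le_exp (by exact_mod_cast hpos)]
    exact hn

lemma le_liminf_log {β : ℕ → ℝ≥0∞} {e : ℕ → ℝ} (he : Tendsto e atTop (nhds 0)) {θ : ℝ}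
    (h : ∀ᶠ n : ℕ in atTop, β n ≤ ENNReal.ofReal (Real.exp (-(n * (θ - e n))))) :
    (θ : EReal) ≤ liminf (fun n : ℕ => ((-(1 / (n : ℝ)) : ℝ) : EReal) * ENNReal.log (β n))
      atTop := by
  have hlim : Tendsto (fun n => ((θ - e n : ℝ) : EReal)) atTop (nhds (θ : EReal)) := by
    refine (continuous_coe_real_ereal.tendsto θ).comp ?_
    simpa using he.const_sub θ
  rw [← hlim.liminf_eq]
  refine liminf_le_liminf ?_
  filter_upwards [h, eventually_gt_atTop 0] with n hn hn0
  have hn0' : (0 : ℝ) < n := by exact_mod_cast hn0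
  have hlog : ENNReal.log (β n) ≤ ((-(n * (θ - e n)) : ℝ) : EReal) := by
    refine (ENNReal.log_monotone hn).trans (le_of_eq ?_)
    rw [ENNReal.log_ofReal_of_pos (Real.exp_pos _), Real.log_exp]
  have hmul := mul_le_mul_of_nonneg_left hlog
    (show (0 : EReal) ≤ ((1 / (n : ℝ) : ℝ) : EReal) by exact_mod_cast (by positivity))
  rw [← EReal.neg_le_neg_iff, ← EReal.coe_mul] at hmul
  rw [EReal.coe_neg, EReal.neg_mul]
  refine le_trans (le_of_eq ?_) hmul
  rw [← EReal.coe_neg, EReal.coe_eq_coe_iff]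
  field_simp

lemma limsup_le_zero {α : ℕ → ℝ≥0∞} {e : ℕ → ℝ} (he : Tendsto e atTop (nhds 0))
    (h : ∀ᶠ n : ℕ in atTop, α n ≤ ENNReal.ofReal (e n)) : limsup α atTop ≤ 0 := by
  have hlim := ENNReal.tendsto_ofReal he
  rw [ENNReal.ofReal_zero] at hlim
  rw [← hlim.limsup_eq]
  exact limsup_le_limsup h

variable [Fintype X] [Fintype Y₁] [Fintype Y₂]

/-- Codes whose parameters are `ε`-close to the desired ones. -/
theorem eventually_exists_code {P Pbar : PMF (X × Y₁ × Y₂)} (hX : P.map Prod.fst ≠ Pbar.map Prod.fst)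
    {R₁ R₂ θ₁ θ₂ : ℝ} (hR₁ : 0 ≤ R₁) (hR₂ : 0 ≤ R₂) (h₁ : θ₁ ∈ thetaSet₁ P Pbar R₁)
    (h₂ : θ₂ ∈ thetaSet₂ P Pbar R₁ R₂) {ε : ℝ} (hε : 0 < ε) :
    ∀ᶠ n : ℕ in atTop, ∃ (W₁ W₂ : ℕ) (c : Code X Y₁ Y₂ n W₁ W₂),
      (W₁ : ℝ) ≤ Real.exp (n * (R₁ + ε)) ∧ (W₂ : ℝ) ≤ Real.exp (n * (R₂ + ε)) ∧
      iidProb Pbar n {ω | c.guess₁ ω = 0} ≤ ENNReal.ofReal ε ∧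
      iidProb P n {ω | c.guess₂ ω = 1} ≤ ENNReal.ofReal ε ∧
      iidProb P n {ω | c.guess₁ ω = 1} ≤ ENNReal.ofReal (Real.exp (-(n * (θ₁ - ε)))) ∧
      iidProb Pbar n {ω | c.guess₂ ω = 0} ≤ ENNReal.ofReal (Real.exp (-(n * (θ₂ - ε)))) := by
  obtain ⟨-, U₁, _, Qbar₁, Q₁, hQbar₁, hQ₁, hθ₁⟩ := h₁
  obtain ⟨-, U, V, _, _, Q, Qbar, hQ, hQbar, hθ₂⟩ := h₂
  obtain ⟨x₀, hx₀⟩ : ∃ x₀, marg (weight P) Prod.fst x₀ ≠ marg (weight Pbar) Prod.fst x₀ := by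
    by_contra! h
    exact hX (weight_injective (by rw [weight_map, weight_map]; exact funext h))
  set η := |marg (weight P) Prod.fst x₀ - marg (weight Pbar) Prod.fst x₀| with hη
  have hη0 : 0 < η := abs_pos.2 (sub_ne_zero.2 hx₀)
  -- A sequence typical for both marginals would force `η ≤ 2 * ε' ≤ 2 * η / 3`. The other half of
  -- `ε` absorbs the factor `3` that comes from adding the two index sets and the failure symbol.
  set ε' := min (ε / 2) (η / 3) with hε'
  have hε'0 : 0 < ε' := by positivity
  have hε'ε : ε' ≤ ε / 2 := min_le_left _ _
  have hε'η : ε' ≤ η / 3 := min_le_right _ _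
  filter_upwards [exists_scheme_single hQbar₁ hQ₁ hθ₁ hε'0, exists_scheme_pair hQ hQbar hθ₂ hε'0,
    eventually_polynomial_le_exp 3 0 (show 0 < ε / 2 by positivity)] with n hn₁ hn₂ hn₃
  obtain ⟨s₁, hM₁, henc₁, hα₁, hβ₁⟩ := hn₁
  obtain ⟨s₂, hM₂, hM₂', henc₂, hα₂, hβ₂⟩ := hn₂
  have hdisj : ∀ x i j, s₁.enc x = some i → s₂.enc x = some j → False := fun x i j hi hj => by
    have hle : ∀ R : PMF (X × Y₁ × Y₂), ε' * marg (weight R) Prod.fst x₀ ≤ ε' := fun R =>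
      mul_le_of_le_one_right hε'0.le (marg_le_one (weight_nonneg R) (sum_weight R) _ _)
    have h1 := (henc₁ x i hi x₀).trans (hle Pbar)
    have h2 := (henc₂ x j hj x₀).trans (hle P)
    rw [abs_sub_comm] at h2
    have h3 := abs_sub_le (marg (weight P) Prod.fst x₀) (freq x x₀)
      (marg (weight Pbar) Prod.fst x₀)
    linarith
  obtain ⟨c, hc₁, hc₂⟩ := exists_code s₁ s₂ hdisj
  have hprob : ∀ (R : PMF (X × Y₁ × Y₂)) {E : Set (Fin n → X × Y₁ × Y₂)}
      {F : (Fin n → X × Y₁ × Y₂) → Prop} {r : ℝ}, (∀ ω, ω ∈ E → F ω) →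
      seqWeight (weight R) n F ≤ r → iidProb R n E ≤ ENNReal.ofReal r := fun R E F r hE hr => by
    rw [iidProb_eq]
    exact ENNReal.ofReal_le_ofReal ((seqWeight_mono (weight_nonneg R) n hE).trans hr)
  have hn0 : (0 : ℝ) ≤ n := Nat.cast_nonneg n
  rw [pow_zero, mul_one] at hn₃
  have hexp : ∀ R : ℝ, 3 * Real.exp (n * (R + ε')) ≤ Real.exp (n * (R + ε)) := fun R => by
    refine (mul_le_mul_of_nonneg_right hn₃ (Real.exp_nonneg _)).trans ?_
    rw [← Real.exp_add, Real.exp_le_exp]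
    nlinarith
  have hone : ∀ R : ℝ, 0 ≤ R → 1 ≤ Real.exp (n * (R + ε')) := fun R hR =>
    Real.one_le_exp (by positivity)
  have hεε' : ∀ θ : ℝ, Real.exp (-(n * (θ - ε'))) ≤ Real.exp (-(n * (θ - ε))) := fun θ => by
    rw [Real.exp_le_exp]; nlinarith
  refine ⟨_, _, c, ?_, ?_, hprob _ (fun ω hω hacc => ?_) (hα₁.trans (by linarith)),
    hprob _ (fun ω hω hacc => ?_) (hα₂.trans (by linarith)),
    hprob _ (fun ω hω => (hc₁ ω).1 hω) (hβ₁.trans (hεε' _)),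
    hprob _ (fun ω hω => (hc₂ ω).1 hω) (hβ₂.trans (hεε' _))⟩
  · push_cast
    linarith [hexp R₁, hone R₁ hR₁]
  · push_cast
    linarith [hexp R₂, hone R₂ hR₂]
  · have h0 : c.guess₁ ω = 0 := hω
    rw [← hc₁ ω, h0] at hacc
    exact absurd hacc (by decide)
  · have h0 : c.guess₂ ω = 1 := hω
    rw [← hc₂ ω, h0] at hacc
    exact absurd hacc (by decide)

/-- Diagonalization: a tolerance tending to zero slowly enough yields one sequence of codes that
meets all six limits. -/
theorem achievable_of_mem {P Pbar : PMF (X × Y₁ × Y₂)} (hX : P.map Prod.fst ≠ Pbar.map Prod.fst)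
    {R₁ R₂ θ₁ θ₂ : ℝ} (hR₁ : 0 ≤ R₁) (hR₂ : 0 ≤ R₂) (h₁ : θ₁ ∈ thetaSet₁ P Pbar R₁)
    (h₂ : θ₂ ∈ thetaSet₂ P Pbar R₁ R₂) : Achievable ![P, Pbar] 0 R₁ R₂ θ₁ θ₂ := by
  obtain ⟨e, he, he0, hev⟩ := exists_tendsto_zero fun ε hε =>
    eventually_exists_code hX hR₁ hR₂ h₁ h₂ hε
  have hall : ∀ n : ℕ, ∃ (W₁ W₂ : ℕ) (c : Code X Y₁ Y₂ n W₁ W₂), _ → _ := fun n => by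
    by_cases h : ∃ (W₁ W₂ : ℕ) (c : Code X Y₁ Y₂ n W₁ W₂),
      (W₁ : ℝ) ≤ Real.exp (n * (R₁ + e n)) ∧ (W₂ : ℝ) ≤ Real.exp (n * (R₂ + e n)) ∧
      iidProb Pbar n {ω | c.guess₁ ω = 0} ≤ ENNReal.ofReal (e n) ∧
      iidProb P n {ω | c.guess₂ ω = 1} ≤ ENNReal.ofReal (e n) ∧
      iidProb P n {ω | c.guess₁ ω = 1} ≤ ENNReal.ofReal (Real.exp (-(n * (θ₁ - e n)))) ∧
      iidProb Pbar n {ω | c.guess₂ ω = 0} ≤ ENNReal.ofReal (Real.exp (-(n * (θ₂ - e n))))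
    · obtain ⟨W₁, W₂, c, hc⟩ := h
      exact ⟨W₁, W₂, c, fun _ => hc⟩
    -- A constant code fills the finitely many blocklengths that may have no good code.
    · exact ⟨1, 1, ⟨fun _ => 0, fun _ _ => 0, fun _ _ => 0, fun _ _ _ => 0⟩, fun h' => absurd h' h⟩
  choose W₁ W₂ c hc using hall
  have hev' := hev.mono fun n hn => hc n hn
  refine ⟨W₁, W₂, c, limsup_le_zero he (hev'.mono fun n hn => hn.2.2.1),
    limsup_le_zero he (hev'.mono fun n hn => hn.2.2.2.1),
    le_liminf_log he (hev'.mono fun n hn => hn.2.2.2.2.1),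
    le_liminf_log he (hev'.mono fun n hn => hn.2.2.2.2.2),
    limsup_log_le he he0 hR₁ (hev'.mono fun n hn => hn.1),
    limsup_log_le he he0 hR₂ (hev'.mono fun n hn => hn.2.1)⟩

end Combination

end ConcurrentDetection

end

theorem mainTheorem8 {X Y₁ Y₂ : Type*} [Fintype X] [Fintype Y₁] [Fintype Y₂]
    (P Pbar : PMF (X × Y₁ × Y₂)) (hX : P.map Prod.fst ≠ Pbar.map Prod.fst)
    (R₁ R₂ : ℝ) (hR₁ : 0 ≤ R₁) (hR₂ : 0 ≤ R₂) :
    ConcurrentDetection.thetaSet₁ P Pbar R₁ ×ˢ ConcurrentDetection.thetaSet₂ P Pbar R₁ R₂ ⊆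
      ConcurrentDetection.exponentsRegion ![P, Pbar] 0 R₁ R₂ := fun _ hθ =>
  subset_closure (ConcurrentDetection.achievable_of_mem hX hR₁ hR₂ hθ.1 hθ.2)
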